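/- An instance of the Restricted Items Selection problem (RIS) consists of $m$ finite sets of items $I_1,\dots,I_m$, an integer cost $c_{ij}$ (of any sign) for each item $j\in I_i$, integers $p_i$ with $0<p_i<|I_i|$, and a set $T$ of forbidden pairs of items, where the two items of a pair may belong to the same set or to different sets. A selection $S_1\subseteq I_1,\dots,S_m\subseteq I_m$ is feasible if $|S_i|=p_i$ for every $i$ and no two items that form a pair in $T$ are both selected (a pair $\{a,a\}$, if present, says that $a$ may not be selected). The task is to find a feasible selection that minimizes the total cost $\sum_i\sum_{j\in S_i}c_{ij}$, or to report that there is none. RIS can be solved in time polynomial in the length of the binary encoding of the instance in each of the following two special cases: (1) each item occurs in at most one forbidden pair, where pairs are unordered; (2) the forbiddance relation is transitive on different items: whenever $\{a,b\}$ and $\{b,d\}$ are forbidden pairs and $a\neq d$, then $\{a,d\}$ is a forbidden pair. Running time is the logarithmic (bit) cost on a random access machine with addition and subtraction, which is polynomially equivalent to the running time of a Turing machine. -/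

import Mathlib

/-! ### The Restricted Items Selection problem -/

/-- An instance of RIS: `m` sets of items, the `i`-th one having `r i` items with integer costs
`c i k`; the number `p i` of items to be selected from the `i`-th set; and the set `T` of forbidden
pairs, listed in any order (only membership in the list matters below). An item is a pair
`⟨i, k⟩`. -/
structure RIS where
  m : ℕ
  r : Fin m → ℕ
  c : (i : Fin m) → Fin (r i) → ℤ
  p : Fin m → ℕ
  p_pos : ∀ i, 0 < p i
  p_lt : ∀ i, p i < r i
  T : List ((Σ i : Fin m, Fin (r i)) × (Σ i : Fin m, Fin (r i)))

namespace RIS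

/-- The items of an instance: `⟨i, k⟩` is the `k`-th item of the `i`-th set. -/
abbrev Item (I : RIS) : Type := Σ i : Fin I.m, Fin (I.r i)

/-- A choice of a subset of each of the item sets. -/
abbrev Selection (I : RIS) : Type := (i : Fin I.m) → Finset (Fin (I.r i))

/-- Exactly `p i` items are selected from the `i`-th set, and no forbidden pair is selected
(for a pair `(a, a)` this says that `a` is not selected, as does `x_a + x_a ≤ 1`). -/
def Feasible (I : RIS) (S : I.Selection) : Prop :=
  (∀ i, (S i).card = I.p i) ∧
    ∀ a b : I.Item, (a, b) ∈ I.T → ¬ (a.2 ∈ S a.1 ∧ b.2 ∈ S b.1)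

/-- The total cost of the selected items. -/
def cost (I : RIS) (S : I.Selection) : ℤ :=
  ∑ i, ∑ k ∈ S i, I.c i k

/-- A feasible selection of minimum total cost. -/
def Optimal (I : RIS) (S : I.Selection) : Prop :=
  I.Feasible S ∧ ∀ S' : I.Selection, I.Feasible S' → I.cost S ≤ I.cost S'

/-- The forbiddance relation: `a` and `b` cannot be selected simultaneously. It is symmetric,
whichever of the two orders a pair is listed in. -/
def Forbids (I : RIS) (a b : I.Item) : Prop :=
  (a, b) ∈ I.T ∨ (b, a) ∈ I.T

/-- Each item occurs in at most one forbidden (unordered) pair. -/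
def AtMostOnePair (I : RIS) : Prop :=
  ∀ a b b' : I.Item, I.Forbids a b → I.Forbids a b' → b = b'

/-- The forbiddance relation between different items is transitive. (The two ends of the chain are
required to be different because a symmetric relation that is transitive without this proviso is
reflexive at every item it involves.) -/
def TransitiveForbiddance (I : RIS) : Prop :=
  ∀ a b d : I.Item, a ≠ d → I.Forbids a b → I.Forbids b d → I.Forbids a d

/-- The code of an item: the index of its set and its index in the set. -/
def encodeItem (I : RIS) (a : I.Item) : List ℤ :=
  [((a.1 : ℕ) : ℤ), ((a.2 : ℕ) : ℤ)]

/-- The input format: `m`; then, for each `i`, the numbers `r i`, `p i` and the costs of the `r i`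
items; then the length of the list of forbidden pairs and the four indices of each pair. -/
def encode (I : RIS) : List ℤ :=
  [(I.m : ℤ)] ++
    (List.finRange I.m).flatMap
      (fun i => [(I.r i : ℤ), (I.p i : ℤ)] ++ List.ofFn (I.c i)) ++
    [(I.T.length : ℤ)] ++
    I.T.flatMap (fun t => I.encodeItem t.1 ++ I.encodeItem t.2)

/-- The characteristic 0-1 vector `(x_11, …, x_1r₁, …, x_m1, …, x_mrₘ)` of a selection. -/
def encodeSelection (I : RIS) (S : I.Selection) : List ℤ :=
  (List.finRange I.m).flatMap
    (fun i => List.ofFn (fun k => if k ∈ S i then (1 : ℤ) else 0))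

/-- `out` is a correct answer to the instance: `1` followed by the characteristic vector of an
optimal selection, or the single number `0` if there is no feasible selection. -/
def IsAnswer (I : RIS) (out : List ℤ) : Prop :=
  (∃ S, I.Optimal S ∧ out = 1 :: I.encodeSelection S) ∨
    ((∀ S, ¬ I.Feasible S) ∧ out = [0])

end RIS

/-! ### A random access machine with logarithmic (bit) costs

The programs are structured programs over integer variables and integer arrays, with addition and
subtraction as the only arithmetic. Every evaluation of a subexpression is charged the bit length of
its value, so that the total is the usual logarithmic cost of a random access machine, which is
polynomially related to the running time of a Turing machine. -/

namespace RAM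

/-- The length of an integer in binary, with its sign. -/
def bitLen (z : ℤ) : ℕ := z.natAbs.size + 1

/-- The bit length of a list of integers. -/
def bitSize (l : List ℤ) : ℕ := (l.map bitLen).sum

/-- The contents of the variables and of the arrays. -/
structure State where
  var : ℕ → ℤ
  arr : ℕ → ℤ → ℤ

/-- Expressions: constants, variables, array entries, sums and differences. -/
inductive Expr where
  | const (z : ℤ)
  | var (x : ℕ)
  | get (a : ℕ) (e : Expr)
  | add (e f : Expr)
  | sub (e f : Expr)

namespace Expr

/-- The value of an expression. -/
def eval (s : State) : Expr → ℤ
  | const z => z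
  | var x => s.var x
  | get a e => s.arr a (e.eval s)
  | add e f => e.eval s + f.eval s
  | sub e f => e.eval s - f.eval s

/-- The cost of an evaluation: the sum of the bit lengths of the values of all subexpressions. -/
def cost (s : State) : Expr → ℕ
  | const z => bitLen z
  | var x => bitLen (s.var x)
  | get a e => e.cost s + bitLen (s.arr a (e.eval s))
  | add e f => e.cost s + f.cost s + bitLen (e.eval s + f.eval s)
  | sub e f => e.cost s + f.cost s + bitLen (e.eval s - f.eval s)

end Expr

/-- Boolean tests. -/
inductive Test where
  | le (e f : Expr)
  | eq (e f : Expr)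
  | not (b : Test)
  | and (b d : Test)

namespace Test

/-- The truth value of a test. -/
def Holds (s : State) : Test → Prop
  | le e f => e.eval s ≤ f.eval s
  | eq e f => e.eval s = f.eval s
  | not b => ¬ b.Holds s
  | and b d => b.Holds s ∧ d.Holds s

/-- The cost of a test. -/
def cost (s : State) : Test → ℕ
  | le e f => e.cost s + f.cost s + 1
  | eq e f => e.cost s + f.cost s + 1
  | not b => b.cost s + 1
  | and b d => b.cost s + d.cost s + 1

end Test

/-- Programs. `assign x e` is `x := e` and `put a e f` is `a[e] := f`. -/
inductive Program where
  | skip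
  | assign (x : ℕ) (e : Expr)
  | put (a : ℕ) (e f : Expr)
  | seq (P Q : Program)
  | ite (b : Test) (P Q : Program)
  | loop (b : Test) (P : Program)

/-- The state after `x := z`. -/
def State.setVar (s : State) (x : ℕ) (z : ℤ) : State :=
  { s with var := Function.update s.var x z }

/-- The state after `a[j] := z`. -/
def State.setArr (s : State) (a : ℕ) (j z : ℤ) : State :=
  { s with arr := Function.update s.arr a (Function.update (s.arr a) j z) }

/-- `Exec P s s' t`: the program `P`, started in the state `s`, halts in the state `s'` after a run
of cost `t`. -/
inductive Exec : Program → State → State → ℕ → Prop where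
  | skip (s : State) : Exec Program.skip s s 1
  | assign (s : State) (x : ℕ) (e : Expr) :
      Exec (Program.assign x e) s (s.setVar x (e.eval s)) (e.cost s + 1)
  | put (s : State) (a : ℕ) (e f : Expr) :
      Exec (Program.put a e f) s (s.setArr a (e.eval s) (f.eval s)) (e.cost s + f.cost s + 1)
  | seq {P Q : Program} {s s' s'' : State} {t t' : ℕ} :
      Exec P s s' t → Exec Q s' s'' t' → Exec (Program.seq P Q) s s'' (t + t')
  | ite_true {b : Test} {P Q : Program} {s s' : State} {t : ℕ} :
      b.Holds s → Exec P s s' t → Exec (Program.ite b P Q) s s' (b.cost s + t)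
  | ite_false {b : Test} {P Q : Program} {s s' : State} {t : ℕ} :
      ¬ b.Holds s → Exec Q s s' t → Exec (Program.ite b P Q) s s' (b.cost s + t)
  | loop_true {b : Test} {P : Program} {s s' s'' : State} {t t' : ℕ} :
      b.Holds s → Exec P s s' t → Exec (Program.loop b P) s' s'' t' →
        Exec (Program.loop b P) s s'' (b.cost s + t + t')
  | loop_false {b : Test} {P : Program} {s : State} :
      ¬ b.Holds s → Exec (Program.loop b P) s s (b.cost s)

/-- The initial state on input `l`: the list is in array 0 and its length in variable 0; everything
else is 0. -/
def State.init (l : List ℤ) : State where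
  var x := if x = 0 then (l.length : ℤ) else 0
  arr a j := if a = 0 ∧ 0 ≤ j then l.getD j.toNat 0 else 0

/-- The output of a halted run: the first entries of array 1, their number being in variable 0. -/
def State.output (s : State) : List ℤ :=
  (List.range (s.var 0).toNat).map (fun j => s.arr 1 (j : ℤ))

/-- On input `l`, the program `P` halts with output `out` after a run of cost at most `t`. -/
def Program.OutputsWithin (P : Program) (l out : List ℤ) (t : ℕ) : Prop :=
  ∃ s t', Exec P (State.init l) s t' ∧ t' ≤ t ∧ s.output = out

end RAM

/-- RIS restricted to the instances with property `C` is solvable in polynomial time: a single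
program answers all of these instances, in time polynomial in the bit size of the input. -/
def RIS.SolvableInPolyTime (C : RIS → Prop) : Prop :=
  ∃ (P : RAM.Program) (q : Polynomial ℕ), ∀ I : RIS, C I →
    ∃ out : List ℤ, I.IsAnswer out ∧
      P.OutputsWithin I.encode out (q.eval (RAM.bitSize I.encode))

namespace RAM

/-! ### Programs with counted loops -/

/-- Programs whose only loops are counted: `times x P` runs `P` for `x = 0, 1, …, n - 1`, where `n`
is the value of variable `0`. -/
inductive ForProg where
  | skip
  | assign (x : ℕ) (e : Expr)
  | put (a : ℕ) (e f : Expr)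
  | seq (P Q : ForProg)
  | ite (b : Test) (P Q : ForProg)
  | times (x : ℕ) (P : ForProg)

namespace ForProg

/-- The variables that a program may change. -/
def writes : ForProg → List ℕ
  | skip => []
  | assign x _ => [x]
  | put _ _ _ => []
  | seq P Q => P.writes ++ Q.writes
  | ite _ P Q => P.writes ++ Q.writes
  | times x P => x :: P.writes

/-- The arrays that a program may change. -/
def writesArr : ForProg → List ℕ
  | skip => []
  | assign _ _ => []
  | put a _ _ => [a]
  | seq P Q => P.writesArr ++ Q.writesArr
  | ite _ P Q => P.writesArr ++ Q.writesArr
  | times _ P => P.writesArr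

/-- No loop changes its counter or the number of its rounds, and variable `0` is changed only after
the last loop. -/
def wf : ForProg → Bool
  | skip => true
  | assign _ _ => true
  | put _ _ _ => true
  | seq P Q => P.wf && Q.wf && decide (0 ∉ P.writes)
  | ite _ P Q => P.wf && Q.wf
  | times x P => P.wf && decide (x ≠ 0) && decide (x ∉ P.writes) && decide (0 ∉ P.writes)

open Classical in
/-- The state reached by a program. -/
noncomputable def run : ForProg → State → State
  | skip => fun s => s
  | assign x e => fun s => s.setVar x (e.eval s)
  | put a e f => fun s => s.setArr a (e.eval s) (f.eval s)
  | seq P Q => fun s => Q.run (P.run s)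
  | ite b P Q => fun s => if b.Holds s then P.run s else Q.run s
  | times x P => fun s =>
      (fun s' => (P.run s').setVar x ((P.run s').var x + 1))^[(s.var 0).toNat] (s.setVar x 0)

/-- The translation of counted loops into conditional loops. -/
def compile : ForProg → Program
  | skip => .skip
  | assign x e => .assign x e
  | put a e f => .put a e f
  | seq P Q => .seq P.compile Q.compile
  | ite b P Q => .ite b P.compile Q.compile
  | times x P => .seq (.assign x (.const 0))
      (.loop (.le (.add (.var x) (.const 1)) (.var 0))
        (.seq P.compile (.assign x (.add (.var x) (.const 1)))))

end ForProg

@[simp] theorem State.setVar_var (s : State) (x : ℕ) (z : ℤ) (y : ℕ) :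
    (s.setVar x z).var y = if y = x then z else s.var y := by
  simp [State.setVar, Function.update_apply]

@[simp] theorem State.setVar_arr (s : State) (x : ℕ) (z : ℤ) : (s.setVar x z).arr = s.arr := rfl

@[simp] theorem State.setArr_var (s : State) (a : ℕ) (j z : ℤ) : (s.setArr a j z).var = s.var := rfl

@[simp] theorem State.setArr_arr (s : State) (a : ℕ) (j z : ℤ) (d : ℕ) :
    (s.setArr a j z).arr d = if d = a then Function.update (s.arr a) j z else s.arr d := by
  by_cases h : d = a
  · subst h; simp [State.setArr]
  · simp [State.setArr, h]

namespace ForProg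

@[simp] theorem run_skip (s : State) : skip.run s = s := rfl
@[simp] theorem run_assign (x : ℕ) (e : Expr) (s : State) :
    (assign x e).run s = s.setVar x (e.eval s) := rfl
@[simp] theorem run_put (a : ℕ) (e f : Expr) (s : State) :
    (put a e f).run s = s.setArr a (e.eval s) (f.eval s) := rfl
@[simp] theorem run_seq (P Q : ForProg) (s : State) : (seq P Q).run s = Q.run (P.run s) := rfl

theorem run_ite_pos {b : Test} {s : State} (h : b.Holds s) (P Q : ForProg) :
    (ite b P Q).run s = P.run s := by simp [run, h]
theorem run_ite_neg {b : Test} {s : State} (h : ¬ b.Holds s) (P Q : ForProg) :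
    (ite b P Q).run s = Q.run s := by simp [run, h]

/-- The state `s'` arises from `s` by changes of the variables `V` and the arrays `A`. -/
def Frame (V A : List ℕ) (s s' : State) : Prop :=
  (∀ x, x ∉ V → s'.var x = s.var x) ∧ ∀ a, a ∉ A → s'.arr a = s.arr a

theorem run_frame (P : ForProg) (s : State) : Frame P.writes P.writesArr s (P.run s) := by
  induction P generalizing s with
  | skip => exact ⟨fun _ _ => rfl, fun _ _ => rfl⟩
  | assign x e => exact ⟨fun y hy => by simp [writes] at hy; simp [hy], fun _ _ => rfl⟩
  | put a e f => exact ⟨fun _ _ => rfl, fun d hd => by simp [writesArr] at hd; simp [hd]⟩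
  | seq P Q hP hQ =>
    constructor
    · intro x hx
      simp only [writes, List.mem_append, not_or] at hx
      rw [run_seq, (hQ _).1 x hx.2, (hP _).1 x hx.1]
    · intro a ha
      simp only [writesArr, List.mem_append, not_or] at ha
      rw [run_seq, (hQ _).2 a ha.2, (hP _).2 a ha.1]
  | ite b P Q hP hQ =>
    constructor
    · intro x hx
      simp only [writes, List.mem_append, not_or] at hx
      by_cases h : b.Holds s
      · rw [run_ite_pos h, (hP _).1 x hx.1]
      · rw [run_ite_neg h, (hQ _).1 x hx.2]
    · intro a ha
      simp only [writesArr, List.mem_append, not_or] at ha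
      by_cases h : b.Holds s
      · rw [run_ite_pos h, (hP _).2 a ha.1]
      · rw [run_ite_neg h, (hQ _).2 a ha.2]
  | times x P hP =>
    have key : ∀ k s', Frame (x :: P.writes) P.writesArr s'
        ((fun s' => (P.run s').setVar x ((P.run s').var x + 1))^[k] s') := by
      intro k
      induction k with
      | zero => exact fun _ => ⟨fun _ _ => rfl, fun _ _ => rfl⟩
      | succ k ih =>
        intro s'
        rw [Function.iterate_succ_apply]
        constructor
        · intro y hy
          rw [(ih _).1 y hy]
          simp only [List.mem_cons, not_or] at hy
          simp [hy.1, (hP s').1 y hy.2]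
        · intro a ha
          rw [(ih _).2 a ha]
          simp [(hP s').2 a ha]
    constructor
    · intro y hy
      have := (key (s.var 0).toNat (s.setVar x 0)).1 y hy
      rw [run, this]
      simp only [writes, List.mem_cons, not_or] at hy
      simp [hy.1]
    · intro a ha
      have := (key (s.var 0).toNat (s.setVar x 0)).2 a ha
      rw [run, this]
      rfl

theorem run_var {P : ForProg} {x : ℕ} (h : x ∉ P.writes) (s : State) :
    (P.run s).var x = s.var x := (run_frame P s).1 x h

theorem run_arr {P : ForProg} {a : ℕ} (h : a ∉ P.writesArr) (s : State) :
    (P.run s).arr a = s.arr a := (run_frame P s).2 a h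

/-- The induction rule for counted loops. -/
theorem run_times {P : ForProg} {x : ℕ} (hwf : (times x P).wf = true) {s : State} {n : ℕ}
    (hn : s.var 0 = n) (Inv : ℕ → State → Prop) (h0 : Inv 0 (s.setVar x 0))
    (hs : ∀ (k : ℕ) (s' : State), k < n → s'.var x = k → Frame (times x P).writes (times x P).writesArr s s' →
      Inv k s' → Inv (k + 1) ((P.run s').setVar x (k + 1))) :
    Inv n ((times x P).run s) := by
  simp only [wf, Bool.and_eq_true, decide_eq_true_eq] at hwf
  obtain ⟨⟨⟨-, hx0⟩, hx⟩, h0P⟩ := hwf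
  have key : ∀ k, k ≤ n → Inv k ((fun s' => (P.run s').setVar x ((P.run s').var x + 1))^[k]
        (s.setVar x 0)) ∧
      ((fun s' => (P.run s').setVar x ((P.run s').var x + 1))^[k] (s.setVar x 0)).var x = k ∧
      Frame (times x P).writes (times x P).writesArr s
        ((fun s' => (P.run s').setVar x ((P.run s').var x + 1))^[k] (s.setVar x 0)) := by
    intro k
    induction k with
    | zero =>
      refine fun _ => ⟨h0, by simp, fun y hy => ?_, fun _ _ => rfl⟩
      simp only [writes, List.mem_cons, not_or] at hy
      simp [hy.1]
    | succ k ih =>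
      intro hk
      obtain ⟨hI, hxk, hF⟩ := ih (by omega)
      rw [Function.iterate_succ_apply']
      generalize (fun s' => (P.run s').setVar x ((P.run s').var x + 1))^[k] (s.setVar x 0) = s' at *
      refine ⟨?_, ?_, ?_, ?_⟩
      · have := hs k s' hk hxk hF hI
        rwa [run_var hx, hxk]
      · simp [run_var hx, hxk]
      · intro y hy
        have hy' := hF.1 y hy
        simp only [writes, List.mem_cons, not_or] at hy
        simp [hy.1, run_var hy.2, hy']
      · intro a ha
        have ha' := hF.2 a ha
        simp [run_arr (P := P) ha, ha']
  have := (key n le_rfl).1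
  simp only [run, hn, Int.toNat_natCast]
  exact this

end ForProg

/-! ### The cost of a program -/

/-- The size of an expression. -/
def Expr.size : Expr → ℕ
  | .const z => bitLen z + 1
  | .var _ => 1
  | .get _ e => e.size + 1
  | .add e f => e.size + f.size + 1
  | .sub e f => e.size + f.size + 1

/-- The size of a test. -/
def Test.size : Test → ℕ
  | .le e f => e.size + f.size + 1
  | .eq e f => e.size + f.size + 1
  | .not b => b.size + 1
  | .and b d => b.size + d.size + 1

/-- All numbers stored are at most `2 ^ b` in absolute value. -/
def State.Bounded (s : State) (b : ℕ) : Prop :=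
  (∀ x, (s.var x).natAbs ≤ 2 ^ b) ∧ ∀ a j, (s.arr a j).natAbs ≤ 2 ^ b

theorem State.Bounded.mono {s : State} {b d : ℕ} (h : s.Bounded b) (hbd : b ≤ d) : s.Bounded d :=
  ⟨fun x => (h.1 x).trans (Nat.pow_le_pow_right (by norm_num) hbd),
    fun a j => (h.2 a j).trans (Nat.pow_le_pow_right (by norm_num) hbd)⟩

theorem bitLen_le {z : ℤ} {b : ℕ} (h : z.natAbs ≤ 2 ^ b) : bitLen z ≤ b + 2 := by
  have : z.natAbs.size ≤ b + 1 :=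
    Nat.size_le.2 (h.trans_lt (Nat.pow_lt_pow_right (by norm_num) (by omega)))
  unfold bitLen; omega

theorem natAbs_le_two_pow_bitLen (z : ℤ) : z.natAbs ≤ 2 ^ bitLen z :=
  (Nat.lt_size_self _).le.trans (Nat.pow_le_pow_right (by norm_num) (by simp [bitLen]))

theorem two_pow_add_two_pow_le (b p q : ℕ) : 2 ^ (b + p) + 2 ^ (b + q) ≤ 2 ^ (b + (p + q + 1)) := by
  have h1 : 2 ^ (b + p) ≤ 2 ^ (b + (p + q)) := Nat.pow_le_pow_right (by norm_num) (by omega)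
  have h2 : 2 ^ (b + q) ≤ 2 ^ (b + (p + q)) := Nat.pow_le_pow_right (by norm_num) (by omega)
  rw [← add_assoc, pow_succ]; omega

theorem Expr.natAbs_eval_le {s : State} {b : ℕ} (h : s.Bounded b) (e : Expr) :
    (e.eval s).natAbs ≤ 2 ^ (b + e.size) := by
  induction e with
  | const z =>
    exact (natAbs_le_two_pow_bitLen z).trans
      (Nat.pow_le_pow_right (by norm_num) (by simp only [size]; omega))
  | var x => exact (h.1 x).trans (Nat.pow_le_pow_right (by norm_num) (by omega))
  | get a e _ => exact (h.2 a _).trans (Nat.pow_le_pow_right (by norm_num) (by omega))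
  | add e f he hf =>
    refine le_trans ?_ (two_pow_add_two_pow_le b e.size f.size)
    simp only [eval]; omega
  | sub e f he hf =>
    refine le_trans ?_ (two_pow_add_two_pow_le b e.size f.size)
    simp only [eval]; omega

theorem Expr.cost_le {s : State} {b : ℕ} (h : s.Bounded b) (e : Expr) :
    e.cost s ≤ e.size * (b + e.size + 2) := by
  have hv := fun e => bitLen_le (Expr.natAbs_eval_le h e)
  induction e with
  | const z => simp only [cost, size]; nlinarith
  | var x =>
    have := bitLen_le (h.1 x)
    simp only [cost, size]; omega
  | get a e he =>
    have := hv (get a e)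
    simp only [cost, size, eval] at *; nlinarith
  | add e f he hf =>
    have := hv (add e f)
    simp only [cost, size, eval] at *; nlinarith
  | sub e f he hf =>
    have := hv (sub e f)
    simp only [cost, size, eval] at *; nlinarith

theorem Test.cost_le {s : State} {b : ℕ} (h : s.Bounded b) (d : Test) :
    d.cost s ≤ d.size * (b + d.size + 2) := by
  induction d with
  | le e f =>
    have := e.cost_le h
    have := f.cost_le h
    simp only [cost, size] at *; nlinarith
  | eq e f =>
    have := e.cost_le h
    have := f.cost_le h
    simp only [cost, size] at *; nlinarith
  | not d hd => simp only [cost, size] at *; nlinarith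
  | and d e hd he => simp only [cost, size] at *; nlinarith

theorem State.Bounded.setVar {s : State} {b : ℕ} (h : s.Bounded b) {z : ℤ}
    (hz : z.natAbs ≤ 2 ^ b) (x : ℕ) : (s.setVar x z).Bounded b := by
  refine ⟨fun y => ?_, h.2⟩
  rw [setVar_var]; split_ifs
  · exact hz
  · exact h.1 y

theorem State.Bounded.setArr {s : State} {b : ℕ} (h : s.Bounded b) {z : ℤ}
    (hz : z.natAbs ≤ 2 ^ b) (a : ℕ) (j : ℤ) : (s.setArr a j z).Bounded b := by
  refine ⟨h.1, fun d i => ?_⟩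
  rw [setArr_arr]; split_ifs
  · rw [Function.update_apply]; split_ifs
    · exact hz
    · exact h.2 _ _
  · exact h.2 _ _

/-- `P`, started in `s`, halts in `s'`, and if the numbers in `s` have at most `b` bits, then `w`
bounds the growth of the numbers, and `w` steps on such numbers the cost. -/
def ExecWork (P : Program) (s s' : State) (w : ℕ) : Prop :=
  ∀ b, s.Bounded b → s'.Bounded (b + w) ∧ ∃ t, Exec P s s' t ∧ t ≤ w * (b + w + 2)

theorem ExecWork.mono {P : Program} {s s' : State} {w w' : ℕ} (h : ExecWork P s s' w)
    (hw : w ≤ w') : ExecWork P s s' w' := by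
  intro b hb
  obtain ⟨h1, t, h2, h3⟩ := h b hb
  exact ⟨h1.mono (by omega), t, h2, h3.trans (Nat.mul_le_mul hw (by omega))⟩

theorem execWork_assign (s : State) (x : ℕ) (e : Expr) :
    ExecWork (.assign x e) s (s.setVar x (e.eval s)) (e.size + 1) := by
  intro b hb
  refine ⟨(hb.mono (by omega)).setVar ((e.natAbs_eval_le hb).trans
    (Nat.pow_le_pow_right (by norm_num) (by omega))) x, _, Exec.assign s x e, ?_⟩
  have := e.cost_le hb
  nlinarith

theorem execWork_put (s : State) (a : ℕ) (e f : Expr) :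
    ExecWork (.put a e f) s (s.setArr a (e.eval s) (f.eval s)) (e.size + f.size + 1) := by
  intro b hb
  refine ⟨(hb.mono (by omega)).setArr ((f.natAbs_eval_le hb).trans
    (Nat.pow_le_pow_right (by norm_num) (by omega))) a _, _, Exec.put s a e f, ?_⟩
  have := e.cost_le hb
  have := f.cost_le hb
  nlinarith

theorem ExecWork.seq {P Q : Program} {s s' s'' : State} {w w' : ℕ} (hP : ExecWork P s s' w)
    (hQ : ExecWork Q s' s'' w') : ExecWork (.seq P Q) s s'' (w + w') := by
  intro b hb
  obtain ⟨h1, t, h2, h3⟩ := hP b hb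
  obtain ⟨h1', t', h2', h3'⟩ := hQ _ h1
  exact ⟨h1'.mono (by omega), _, Exec.seq h2 h2', by nlinarith⟩

theorem ExecWork.loop_true {d : Test} {P : Program} {s s' s'' : State} {w w' : ℕ}
    (hd : d.Holds s) (hP : ExecWork P s s' w) (hQ : ExecWork (.loop d P) s' s'' w') :
    ExecWork (.loop d P) s s'' (d.size + w + w') := by
  intro b hb
  obtain ⟨h1, t, h2, h3⟩ := hP b hb
  obtain ⟨h1', t', h2', h3'⟩ := hQ _ h1
  have := d.cost_le hb
  exact ⟨h1'.mono (by omega), _, Exec.loop_true hd h2 h2', by nlinarith⟩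

theorem execWork_loop_false {d : Test} {P : Program} {s : State} (hd : ¬ d.Holds s) :
    ExecWork (.loop d P) s s d.size :=
  fun _ hb => ⟨hb.mono (by omega), _, Exec.loop_false hd, d.cost_le hb⟩

namespace ForProg

/-- A bound for the number of steps of a program, in terms of the number of rounds of its loops. -/
noncomputable def work : ForProg → Polynomial ℕ
  | skip => 1
  | assign _ e => Polynomial.C (e.size + 1)
  | put _ e f => Polynomial.C (e.size + f.size + 1)
  | seq P Q => P.work + Q.work
  | ite b P Q => Polynomial.C b.size + (P.work + Q.work)
  | times _ P => Polynomial.X * (P.work + 13) + 10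

theorem work_mono (P : ForProg) {n n' : ℕ} (h : n ≤ n') : P.work.eval n ≤ P.work.eval n' := by
  induction P with
  | skip => simp [work]
  | assign _ _ => simp [work]
  | put _ _ _ => simp [work]
  | seq P Q hP hQ => simp only [work, Polynomial.eval_add]; omega
  | ite b P Q hP hQ => simp only [work, Polynomial.eval_add, Polynomial.eval_C]; omega
  | times x P hP =>
    have := Nat.mul_le_mul h (Nat.add_le_add_right hP 13)
    simpa [work] using this

theorem execWork_compile {P : ForProg} (hP : P.wf = true) {s : State} {n : ℕ} (hn : s.var 0 = n) :
    ExecWork P.compile s (P.run s) (P.work.eval n) := by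
  induction P generalizing s with
  | skip => exact fun b hb => ⟨hb.mono (by omega), 1, Exec.skip s, by simp [work]⟩
  | assign x e => simpa [work, compile] using execWork_assign s x e
  | put a e f => simpa [work, compile] using execWork_put s a e f
  | seq P Q ihP ihQ =>
    simp only [wf, Bool.and_eq_true, decide_eq_true_eq] at hP
    have h0 : (P.run s).var 0 = n := by rw [run_var hP.2, hn]
    simpa [work, compile] using (ihP hP.1.1 hn).seq (ihQ hP.1.2 h0)
  | ite d P Q ihP ihQ =>
    simp only [wf, Bool.and_eq_true] at hP
    intro b hb
    have hc := d.cost_le hb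
    by_cases h : d.Holds s
    · obtain ⟨h1, t, h2, h3⟩ := ihP hP.1 hn b hb
      rw [run_ite_pos h]
      simp only [work, Polynomial.eval_add, Polynomial.eval_C]
      exact ⟨h1.mono (by omega), _, Exec.ite_true h h2, by nlinarith⟩
    · obtain ⟨h1, t, h2, h3⟩ := ihQ hP.2 hn b hb
      rw [run_ite_neg h]
      simp only [work, Polynomial.eval_add, Polynomial.eval_C]
      exact ⟨h1.mono (by omega), _, Exec.ite_false h h2, by nlinarith⟩
  | times x P ihP =>
    simp only [wf, Bool.and_eq_true, decide_eq_true_eq] at hP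
    obtain ⟨⟨⟨hwf, hx0⟩, hx⟩, h0P⟩ := hP
    have hb1 : bitLen 1 = 2 := by simp [bitLen, Nat.size_one]
    have hb0 : bitLen 0 = 1 := by simp [bitLen]
    have key : ∀ (k : ℕ) (s' : State), s'.var 0 = (n : ℤ) → s'.var x = (n : ℤ) - k →
        ExecWork (.loop (.le (.add (.var x) (.const 1)) (.var 0))
          (.seq P.compile (.assign x (.add (.var x) (.const 1))))) s'
          ((fun s' => (P.run s').setVar x ((P.run s').var x + 1))^[k] s')
          (k * (P.work.eval n + 13) + 7) := by
      intro k
      induction k with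
      | zero =>
        intro s' h0 hxk
        refine (execWork_loop_false ?_).mono ?_
        · simp [Test.Holds, Expr.eval, h0, hxk]
        · simp [Test.size, Expr.size, hb1]
      | succ k ih =>
        intro s' h0 hxk
        have h0' : ((P.run s').setVar x ((P.run s').var x + 1)).var 0 = n := by
          simp [Ne.symm hx0, run_var h0P, h0]
        have hxk' : ((P.run s').setVar x ((P.run s').var x + 1)).var x = (n : ℤ) - k := by
          simp [run_var hx, hxk]; ring
        rw [Function.iterate_succ_apply]
        refine (ExecWork.loop_true ?_ ((ihP hwf h0).seq (execWork_assign _ _ _))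
          (ih _ h0' hxk')).mono ?_
        · simp only [Test.Holds, Expr.eval, h0, hxk]; push_cast; omega
        · simp only [Test.size, Expr.size, hb1]; push_cast; linarith
    have h0' : (s.setVar x 0).var 0 = n := by simp [Ne.symm hx0, hn]
    have := (execWork_assign s x (.const 0)).seq (key n _ h0' (by simp [Expr.eval]))
    simp only [run, compile, hn, Int.toNat_natCast]
    refine this.mono ?_
    simp only [work, Expr.size, hb0, Polynomial.eval_add, Polynomial.eval_mul, Polynomial.eval_X,
      Polynomial.eval_ofNat]
    omega

/-- A program with counted loops, started on an input of bit size `B`, halts within a number of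
steps polynomial in `B`. -/
theorem outputsWithin_compile {P : ForProg} (hP : P.wf = true) (l : List ℤ) :
    P.compile.OutputsWithin l (P.run (State.init l)).output
      ((P.work * (Polynomial.X + P.work + 2)).eval (bitSize l)) := by
  have hlen : l.length ≤ bitSize l := by
    unfold bitSize
    induction l with
    | nil => simp
    | cons z l ih => simp only [List.length_cons, List.map_cons, List.sum_cons, bitLen]; omega
  have hmem : ∀ z ∈ l, bitLen z ≤ bitSize l := fun z hz =>
    List.single_le_sum (fun _ _ => Nat.zero_le _) _ (List.mem_map_of_mem hz)
  have hb : (State.init l).Bounded (bitSize l) := by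
    constructor
    · intro x
      simp only [State.init]
      split_ifs
      · exact hlen.trans Nat.lt_two_pow_self.le
      · simp
    · intro a j
      simp only [State.init]
      split_ifs
      · rcases lt_or_ge j.toNat l.length with h | h
        · rw [List.getD_eq_getElem _ _ h]
          exact (natAbs_le_two_pow_bitLen _).trans
            (Nat.pow_le_pow_right (by norm_num) (hmem _ (List.getElem_mem h)))
        · simp [h]
      · simp
  have h := (execWork_compile hP (s := State.init l) (n := l.length) (by simp [State.init])).mono
    (P.work_mono hlen)
  obtain ⟨-, t, h1, h2⟩ := h _ hb
  exact ⟨_, t, h1, by simpa using h2, rfl⟩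

end ForProg
end RAM

/-! ### The assignment problem: augmenting paths and dual solutions -/

namespace Assignment

variable {W : ℕ → ℕ → ℤ} {n : ℕ} {u v : ℤ → ℤ} {μ : ℕ → ℕ}

/-- `μ` maps the rows injectively to columns, `u` and `v` are dual feasible, and the rows that are
mapped to columns below `n` are mapped along tight edges. -/
structure Partial (W : ℕ → ℕ → ℤ) (n : ℕ) (u v : ℤ → ℤ) (μ : ℕ → ℕ) : Prop where
  inj : ∀ r < n, ∀ r' < n, μ r = μ r' → r = r'
  feas : ∀ r < n, ∀ j < n, u r + v j ≤ W r j
  tight : ∀ r < n, μ r < n → u r + v (μ r) = W r (μ r)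

/-- The rows from `i` on are mapped to columns of their own, beyond the `n` columns of the
problem. -/
structure Stage (n i : ℕ) (μ : ℕ → ℕ) : Prop where
  done : ∀ r < i, μ r < n
  rest : ∀ r, i ≤ r → r < n → μ r = n + r

/-- The columns `j` with `1 ≤ vis j` form a tree of alternating paths that start in the row `i`. -/
structure Tree (W : ℕ → ℕ → ℤ) (n i : ℕ) (u v : ℤ → ℤ) (μ : ℕ → ℕ) (vis : ℤ → ℤ) (way : ℕ → ℕ) :
    Prop where
  root : vis ((n + i : ℕ) : ℤ) = 1
  virt : ∀ j : ℕ, n ≤ j → j < 2 * n → j ≠ n + i → vis j = 0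
  real : ∀ j : ℕ, j < n → vis j = 0 ∨ 2 ≤ vis j
  way_spec : ∀ j : ℕ, j < n → 1 ≤ vis j → way j < n ∧ 1 ≤ vis (μ (way j)) ∧
    vis (μ (way j)) < vis j ∧ u (way j) + v j = W (way j) j

/-- A row-perfect matching along tight edges is optimal. -/
theorem Partial.sum_le (h : Partial W n u v μ) (hμ : ∀ r < n, μ r < n) {τ : ℕ → ℕ}
    (hτ : ∀ r < n, τ r < n) (hτi : ∀ r < n, ∀ r' < n, τ r = τ r' → r = r') :
    ∑ r ∈ Finset.range n, W r (μ r) ≤ ∑ r ∈ Finset.range n, W r (τ r) := by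
  have key : ∀ ρ : ℕ → ℕ, (∀ r < n, ρ r < n) → (∀ r < n, ∀ r' < n, ρ r = ρ r' → r = r') →
      ∑ r ∈ Finset.range n, (u r + v (ρ r)) =
        ∑ r ∈ Finset.range n, u r + ∑ j ∈ Finset.range n, v j := by
    intro ρ h1 h2
    rw [Finset.sum_add_distrib]
    congr 1
    have hinj : Set.InjOn ρ (Finset.range n) := fun r hr r' hr' =>
      h2 r (by simpa using hr) r' (by simpa using hr')
    have himg : (Finset.range n).image ρ = Finset.range n := by
      refine Finset.eq_of_subset_of_card_le ?_ ?_
      · intro j hj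
        obtain ⟨r, hr, rfl⟩ := Finset.mem_image.1 hj
        simpa using h1 r (by simpa using hr)
      · rw [Finset.card_image_of_injOn hinj]
    conv_rhs => rw [← himg]
    rw [Finset.sum_image hinj]
  calc ∑ r ∈ Finset.range n, W r (μ r)
      = ∑ r ∈ Finset.range n, (u r + v (μ r)) :=
        Finset.sum_congr rfl fun r hr => by
          have hr := Finset.mem_range.1 hr
          exact (h.tight r hr (hμ r hr)).symm
    _ = ∑ r ∈ Finset.range n, (u r + v (τ r)) := by rw [key μ hμ h.inj, key τ hτ hτi]
    _ ≤ _ := Finset.sum_le_sum fun r hr => by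
          have hr := Finset.mem_range.1 hr
          exact h.feas r hr _ (hτ r hr)

/-- If only matched columns are visited, then some column is not visited. -/
theorem exists_not_visited {i : ℕ} (hs : Stage n i μ) (hi : i < n)
    {vis : ℤ → ℤ} (hm : ∀ j < n, 1 ≤ vis j → ∃ r < n, μ r = j) : ∃ j < n, ¬ 1 ≤ vis j := by
  by_contra! hall
  have hex : ∀ j < n, ∃ r < n, μ r = j := fun j hj => hm j hj (by simpa using hall j hj)
  choose! f hf1 hf2 using hex
  have hmaps : ∀ j ∈ Finset.range n, f j ∈ (Finset.range n).erase i := by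
    intro j hj
    have hj := Finset.mem_range.1 hj
    refine Finset.mem_erase.2 ⟨fun hc => ?_, Finset.mem_range.2 (hf1 j hj)⟩
    have h1 := hf2 j hj
    rw [hc, hs.rest i le_rfl hi] at h1
    omega
  have hcard : ((Finset.range n).erase i).card < (Finset.range n).card :=
    Finset.card_erase_lt_of_mem (Finset.mem_range.2 hi)
  obtain ⟨j, hj, j', hj', hne, heq⟩ := Finset.exists_ne_map_eq_of_card_lt_of_maps_to hcard hmaps
  apply hne
  rw [← hf2 j (Finset.mem_range.1 hj), ← hf2 j' (Finset.mem_range.1 hj'), heq]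

theorem Stage.lt {i : ℕ} (hs : Stage n i μ) {r : ℕ} (hr : r < n) : μ r < 2 * n := by
  rcases lt_or_ge r i with h | h
  · have := hs.done r h; omega
  · have := hs.rest r h hr; omega

variable {i : ℕ} {vis : ℤ → ℤ} {way : ℕ → ℕ}

theorem Stage.visited_iff (hs : Stage n i μ) (ht : Tree W n i u v μ vis way) {r : ℕ} (hr : r < n)
    (h : μ r ≥ n) : 1 ≤ vis (μ r) ↔ r = i := by
  have hir : i ≤ r := by
    by_contra hc
    have := hs.done r (by omega); omega
  have h1 := hs.rest r hir hr
  constructor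
  · intro h2
    by_contra hne
    have := ht.virt (μ r) h (hs.lt hr) (by omega)
    omega
  · rintro rfl
    rw [h1, ht.root]

/-- The effect of a change of the dual solution. -/
theorem dual_update {u' v' : ℤ → ℤ} {δ : ℤ} (h : Partial W n u v μ)
    (ht : Tree W n i u v μ vis way)
    (hδ : ∀ r < n, ∀ j < n, 1 ≤ vis (μ r) → ¬ 1 ≤ vis j → δ ≤ W r j - u r - v j) (hδ0 : 0 ≤ δ)
    (hu : ∀ r : ℕ, r < n → u' r = if 1 ≤ vis (μ r) then u r + δ else u r)
    (hv : ∀ j : ℕ, j < n → v' j = if 1 ≤ vis j then v j - δ else v j) :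
    Partial W n u' v' μ ∧ Tree W n i u' v' μ vis way := by
  refine ⟨⟨h.inj, ?_, ?_⟩, ht.root, ht.virt, ht.real, ?_⟩
  · intro r hr j hj
    have h1 := h.feas r hr j hj
    have h2 := hδ r hr j hj
    rw [hu r hr, hv j hj]
    split_ifs with h3 h4 h4
    · linarith
    · linarith [h2 h3 h4]
    · linarith
    · linarith
  · intro r hr hm
    have h1 := h.tight r hr hm
    rw [hu r hr, hv _ hm]
    split_ifs
    · linarith
    · linarith
  · intro j hj hvj
    obtain ⟨h1, h2, h3, h4⟩ := ht.way_spec j hj hvj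
    refine ⟨h1, h2, h3, ?_⟩
    rw [hu _ h1, hv _ hj, if_pos h2, if_pos hvj]
    linarith

/-- The effect of a visit of a new column `j`, along a tight edge from the row `r`. -/
theorem Tree.visit {r j : ℕ} {t : ℤ} (ht : Tree W n i u v μ vis way) (hr : r < n) (hj : j < n)
    (hvr : 1 ≤ vis (μ r)) (hvj : ¬ 1 ≤ vis j) (htight : u r + v j = W r j)
    (hbd : ∀ j : ℕ, j < 2 * n → vis j ≤ t + 1) (ht0 : 0 ≤ t) (hs : Stage n i μ) :
    Tree W n i u v μ (Function.update vis j (t + 2)) (Function.update way j r) := by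
  have hne : ∀ j' : ℕ, 1 ≤ vis j' → (Function.update vis (j : ℤ) (t + 2)) j' = vis j' := by
    intro j' h1
    have : (j' : ℤ) ≠ j := by
      intro hc; rw [hc] at h1; exact hvj h1
    simp [this]
  refine ⟨?_, ?_, ?_, ?_⟩
  · rw [hne _ (by rw [ht.root]), ht.root]
  · intro j' h1 h2 h3
    have : (j' : ℤ) ≠ j := by omega
    simpa [this] using ht.virt j' h1 h2 h3
  · intro j' hj'
    by_cases h : j' = j
    · subst h; right; simp; omega
    · have : (j' : ℤ) ≠ j := by omega
      simpa [this] using ht.real j' hj'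
  · intro j' hj' hv'
    by_cases h : j' = j
    · subst h
      simp only [Function.update_self]
      rw [hne _ hvr]
      refine ⟨hr, hvr, ?_, htight⟩
      have := hbd (μ r) (hs.lt hr)
      omega
    · have h' : (j' : ℤ) ≠ j := by omega
      simp only [ne_eq, h', not_false_eq_true, Function.update_of_ne] at hv'
      obtain ⟨h1, h2, h3, h4⟩ := ht.way_spec j' hj' hv'
      simp only [ne_eq, h', h, not_false_eq_true, Function.update_of_ne]
      rw [hne _ h2]
      exact ⟨h1, h2, h3, h4⟩

/-- The state of the matching while it is changed along an alternating path: `c` is the column that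
has just been left by its row. -/
structure Augmenting (W : ℕ → ℕ → ℤ) (n i : ℕ) (u v : ℤ → ℤ) (μ : ℕ → ℕ) (vis : ℤ → ℤ)
    (way : ℕ → ℕ) (c : ℕ) : Prop where
  lt : c < n
  visited : 2 ≤ vis c
  free : ∀ r < n, μ r ≠ c
  stage : Stage n i μ
  root : vis ((n + i : ℕ) : ℤ) = 1
  real : ∀ j : ℕ, j < n → vis j = 0 ∨ 2 ≤ vis j
  way_spec : ∀ j : ℕ, j < n → 1 ≤ vis j → vis j ≤ vis c → way j < n ∧ 1 ≤ vis (μ (way j)) ∧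
    vis (μ (way j)) < vis j ∧ u (way j) + v j = W (way j) j
  root_unique : ∀ r < n, n ≤ μ r → 1 ≤ vis (μ r) → r = i

theorem Augmenting.step {c : ℕ} (h : Partial W n u v μ) (ha : Augmenting W n i u v μ vis way c)
    (hi : i < n) :
    Partial W n u v (Function.update μ (way c) c) ∧
      ((μ (way c) = n + i ∧ Stage n (i + 1) (Function.update μ (way c) c)) ∨
        (vis (μ (way c)) < vis c ∧
          Augmenting W n i u v (Function.update μ (way c) c) vis way (μ (way c)))) := by
  obtain ⟨h1, h2, h3, h4⟩ := ha.way_spec c ha.lt (by linarith [ha.visited]) le_rfl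
  have hP : Partial W n u v (Function.update μ (way c) c) := by
    refine ⟨?_, h.feas, ?_⟩
    · intro r hr r' hr' he
      by_cases hrw : r = way c <;> by_cases hrw' : r' = way c
      · rw [hrw, hrw']
      · simp only [hrw, Function.update_self, ne_eq, hrw', not_false_eq_true,
          Function.update_of_ne] at he
        exact absurd he.symm (ha.free r' hr')
      · simp only [hrw', Function.update_self, ne_eq, hrw, not_false_eq_true,
          Function.update_of_ne] at he
        exact absurd he (ha.free r hr)
      · simp only [ne_eq, hrw, hrw', not_false_eq_true, Function.update_of_ne] at he
        exact h.inj r hr r' hr' he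
    · intro r hr hm
      by_cases hrw : r = way c
      · subst hrw; simpa using h4
      · simp only [ne_eq, hrw, not_false_eq_true, Function.update_of_ne] at hm ⊢
        exact h.tight r hr hm
  refine ⟨hP, ?_⟩
  rcases lt_or_ge (μ (way c)) n with hlt | hge
  · right
    refine ⟨h3, hlt, ?_, ?_, ?_, ha.root, ha.real, ?_, ?_⟩
    · rcases ha.real _ hlt with h5 | h5 <;> omega
    · intro r hr
      by_cases hrw : r = way c
      · rw [hrw, Function.update_self]
        intro hc
        rw [← hc] at h3; omega
      · simp only [ne_eq, hrw, not_false_eq_true, Function.update_of_ne]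
        exact fun hc => hrw (h.inj r hr _ h1 hc)
    · have hwi : way c < i := by
        by_contra hc
        have := ha.stage.rest (way c) (by omega) h1; omega
      constructor
      · intro r hr
        by_cases hrw : r = way c
        · rw [hrw, Function.update_self]; exact ha.lt
        · simpa [hrw] using ha.stage.done r hr
      · intro r hr hrn
        have hrw : r ≠ way c := by omega
        simpa [hrw] using ha.stage.rest r hr hrn
    · intro j hj hv1 hv2
      obtain ⟨g1, g2, g3, g4⟩ := ha.way_spec j hj hv1 (by omega)
      have hne : way j ≠ way c := by
        intro hc; rw [hc] at g3; omega
      simp only [ne_eq, hne, not_false_eq_true, Function.update_of_ne]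
      exact ⟨g1, g2, g3, g4⟩
    · intro r hr hm hv
      by_cases hrw : r = way c
      · rw [hrw, Function.update_self] at hm
        have := ha.lt; omega
      · simp only [ne_eq, hrw, not_false_eq_true, Function.update_of_ne] at hm hv
        exact ha.root_unique r hr hm hv
  · left
    have hwi := ha.root_unique _ h1 hge h2
    rw [hwi]
    refine ⟨ha.stage.rest i le_rfl hi, ?_, ?_⟩
    · intro r hr
      by_cases hrw : r = i
      · rw [hrw, Function.update_self]; exact ha.lt
      · simpa [hrw] using ha.stage.done r (by omega)
    · intro r hr hrn
      have hrw : r ≠ i := by omega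
      simpa [hrw] using ha.stage.rest r (by omega) hrn

theorem Tree.augmenting (ht : Tree W n i u v μ vis way) (hs : Stage n i μ) {c : ℕ} (hc : c < n)
    (hv : 1 ≤ vis c) (hfree : ∀ r < n, μ r ≠ c) : Augmenting W n i u v μ vis way c where
  lt := hc
  visited := by rcases ht.real c hc with h | h <;> omega
  free := hfree
  stage := hs
  root := ht.root
  real := ht.real
  way_spec := fun j hj h _ => ht.way_spec j hj h
  root_unique := fun _ hr h1 h2 => (hs.visited_iff ht hr h1).1 h2

end Assignment

namespace RAM

open ForProg

/-- The data of the assignment problem: the items `q` with their costs, the number `set q` of the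
set of an item, the number `row r` of the set that the row `r` selects an item of (`0` if there is
no such set), the column `rep q` of an item, and whether an item is excluded. -/
structure Table where
  bound : ℤ
  cost : ℤ → ℤ
  set : ℤ → ℤ
  row : ℤ → ℤ
  rep : ℤ → ℤ
  bad : ℤ → ℤ

/-- The table in the memory: its entries are in variable `2` and in the arrays `0`, `3`, …, `6`. -/
def State.table (s : State) : Table :=
  ⟨s.var 2, s.arr 0, s.arr 3, s.arr 4, s.arr 5, s.arr 6⟩

namespace Table

/-- The item `q` may be selected by the row `r` through the column `j`. -/
def Fits (D : Table) (r j q : ℤ) : Prop :=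
  D.set q = D.row r ∧ D.bad q = 0 ∧ D.rep q = j

open Classical in
/-- The least cost of an item below `k` that the row `r` may select through the column `j`, or
`D.bound` if there is none, together with such an item. -/
noncomputable def scan (D : Table) (r j : ℤ) : ℕ → ℤ × ℤ
  | 0 => (D.bound, 0)
  | k + 1 => if D.Fits r j k ∧ D.cost k < (D.scan r j k).1 then (D.cost k, k) else D.scan r j k

open Classical in
/-- The cost of the column `j` for the row `r`. -/
noncomputable def weight (D : Table) (n : ℕ) (r j : ℤ) : ℤ :=
  if D.row r = 0 then 0 else (D.scan r j n).1

theorem scan_spec (D : Table) (r j : ℤ) (k : ℕ) :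
    ((D.scan r j k).1 = D.bound ∨ ∃ q : ℕ, q < k ∧ D.Fits r j q ∧ (D.scan r j k).1 = D.cost q ∧
      (D.scan r j k).2 = q) ∧ ∀ q : ℕ, q < k → D.Fits r j q → (D.scan r j k).1 ≤ D.cost q := by
  induction k with
  | zero => simp [scan]
  | succ k ih =>
    rw [scan]
    split_ifs with h
    · refine ⟨Or.inr ⟨k, by omega, h.1, rfl, rfl⟩, fun q hq hf => ?_⟩
      rcases Nat.lt_succ_iff_lt_or_eq.1 hq with hlt | rfl
      · exact h.2.le.trans (ih.2 q hlt hf)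
      · exact le_rfl
    · refine ⟨ih.1.imp id fun ⟨q, h1, h2⟩ => ⟨q, by omega, h2⟩, fun q hq hf => ?_⟩
      rcases Nat.lt_succ_iff_lt_or_eq.1 hq with hlt | rfl
      · exact ih.2 q hlt hf
      · exact not_lt.1 fun hc => h ⟨hf, hc⟩

end Table

theorem State.table_eq_of_frame {V A : List ℕ} {s s' : State} (h : Frame V A s s') (h2 : 2 ∉ V)
    (h0 : 0 ∉ A) (h3 : 3 ∉ A) (h4 : 4 ∉ A) (h5 : 5 ∉ A) (h6 : 6 ∉ A) : s'.table = s.table := by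
  simp only [State.table, h.1 2 h2, h.2 0 h0, h.2 3 h3, h.2 4 h4, h.2 5 h5, h.2 6 h6]

/-- Computes the cost of the column (variable `4`) for the row (variable `3`), in variable `5`, and
the item, in variable `6`. -/
def entryProg : ForProg :=
  .ite (.eq (.get 4 (.var 3)) (.const 0)) (.assign 5 (.const 0))
    (.seq (.assign 5 (.var 2)) (.seq (.assign 6 (.const 0))
      (.times 7 (.ite
        (.and (.and (.eq (.get 3 (.var 7)) (.get 4 (.var 3))) (.eq (.get 6 (.var 7)) (.const 0)))
          (.and (.eq (.get 5 (.var 7)) (.var 4))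
            (.not (.le (.var 5) (.get 0 (.var 7))))))
        (.seq (.assign 5 (.get 0 (.var 7))) (.assign 6 (.var 7))) .skip))))

theorem entryProg_spec {s : State} {n : ℕ} (hn : s.var 0 = n) :
    (entryProg.run s).var 5 = s.table.weight n (s.var 3) (s.var 4) ∧
      (s.arr 4 (s.var 3) ≠ 0 →
        (entryProg.run s).var 6 = (s.table.scan (s.var 3) (s.var 4) n).2) := by
  unfold entryProg
  by_cases h : s.arr 4 (s.var 3) = 0
  · rw [run_ite_pos (by simpa [Test.Holds, Expr.eval] using h)]
    exact ⟨by simp [Expr.eval, Table.weight, State.table, h], fun hc => absurd h hc⟩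
  · rw [run_ite_neg (by simpa [Test.Holds, Expr.eval] using h)]
    simp only [run_seq]
    have := run_times (P := .ite
        (.and (.and (.eq (.get 3 (.var 7)) (.get 4 (.var 3))) (.eq (.get 6 (.var 7)) (.const 0)))
          (.and (.eq (.get 5 (.var 7)) (.var 4))
            (.not (.le (.var 5) (.get 0 (.var 7))))))
        (.seq (.assign 5 (.get 0 (.var 7))) (.assign 6 (.var 7))) .skip) (x := 7) (by decide)
        (s := ((assign 6 (.const 0)).run ((assign 5 (.var 2)).run s))) (n := n)
        (by simpa using hn)
        (fun k s' => (s'.var 5, s'.var 6) = s.table.scan (s.var 3) (s.var 4) k)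
        (by simp [Table.scan, Expr.eval, State.table]) ?_
    · rw [Prod.ext_iff] at this
      exact ⟨this.1.trans (by simp [Table.weight, State.table, h]), fun _ => this.2⟩
    · intro k s' hk hx hF hI
      have e3 : s'.var 3 = s.var 3 := by rw [hF.1 3 (by decide)]; simp
      have e4 : s'.var 4 = s.var 4 := by rw [hF.1 4 (by decide)]; simp
      have ea : s'.arr = s.arr := by
        funext a; rw [hF.2 a (by simp [writesArr])]; simp
      have h5 : s'.var 5 = (s.table.scan (s.var 3) (s.var 4) k).1 := by rw [← hI]
      by_cases hc : s.table.Fits (s.var 3) (s.var 4) k ∧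
          s.table.cost k < (s.table.scan (s.var 3) (s.var 4) k).1
      · rw [run_ite_pos, Table.scan, if_pos hc]
        · simp [Expr.eval, hx, ea, State.table]
        · rw [← h5] at hc
          simpa [Test.Holds, Expr.eval, hx, ea, e3, e4, State.table, Table.Fits, and_assoc]
            using hc
      · rw [run_ite_neg, Table.scan, if_neg hc]
        · simpa using hI
        · rw [← h5] at hc
          simpa [Test.Holds, Expr.eval, hx, ea, e3, e4, State.table, Table.Fits, and_assoc]
            using hc

/-- A loop that changes the entries of one array in turn. -/
theorem run_times_map {P : ForProg} {x : ℕ} (hwf : (times x P).wf = true) {s : State} {n : ℕ}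
    (hn : s.var 0 = n) (a : ℕ) (g : ℤ → ℤ)
    (h : ∀ (k : ℕ) (s' : State), k < n → s'.var x = k →
      Frame (times x P).writes (times x P).writesArr s s' → s'.arr a k = s.arr a k →
      (P.run s').arr a = Function.update (s'.arr a) k (g k)) (k : ℕ) (hk : k < n) :
    ((times x P).run s).arr a k = g k := by
  have := run_times hwf hn (fun l s' => ∀ k : ℕ, (k < l → s'.arr a k = g k) ∧
    (l ≤ k → s'.arr a k = s.arr a k)) (by simp) ?_
  · exact (this k).1 hk
  · intro l s' hl hx hF hI k
    rw [State.setVar_arr, h l s' hl hx hF ((hI l).2 le_rfl)]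
    constructor
    · intro hkl
      by_cases hc : k = l
      · simp [hc]
      · have : (k : ℤ) ≠ l := by omega
        simpa [this] using (hI k).1 (by omega)
    · intro hlk
      have : (k : ℤ) ≠ l := by omega
      simpa [this] using (hI k).2 (by omega)

/-! ### The Hungarian algorithm

The dual solution is in the arrays `7` (rows) and `8` (columns), the column of a row in array `9`.
Array `10` tells when a column has been visited, and array `11` from which row. -/

/-- The slack of the column in variable `4` and the row in variable `3`. -/
def slackExpr : Expr :=
  .sub (.sub (.var 5) (.get 7 (.var 3))) (.get 8 (.var 4))

/-- One comparison in the search for the least slack. -/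
def compareProg : ForProg :=
  .seq entryProg (.ite
    (.and (.and (.le (.const 1) (.get 10 (.get 9 (.var 3))))
      (.not (.le (.const 1) (.get 10 (.var 4)))))
      (.not (.and (.eq (.var 8) (.const 1)) (.le (.var 9) slackExpr))))
    (.seq (.assign 9 slackExpr) (.seq (.assign 10 (.var 3)) (.seq (.assign 11 (.var 4))
      (.assign 8 (.const 1))))) .skip)

/-- Finds a visited row and a column that is not visited with the least slack. -/
def minSlackProg : ForProg :=
  .seq (.assign 8 (.const 0)) (.times 3 (.times 4 compareProg))

/-- The candidates for the least slack. -/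
def State.Cand (s : State) (r j : ℕ) : Prop :=
  1 ≤ s.arr 10 (s.arr 9 r) ∧ ¬ 1 ≤ s.arr 10 j

/-- The slack. -/
noncomputable def State.slack (s : State) (n r j : ℕ) : ℤ :=
  s.table.weight n r j - s.arr 7 r - s.arr 8 j

/-- The variables of `s'` describe a candidate of least slack among the pairs in `D`. -/
def IsMinSlack (s : State) (n : ℕ) (D : ℕ → ℕ → Prop) (s' : State) : Prop :=
  (s'.var 8 = 0 ∧ ∀ r j, D r j → ¬ s.Cand r j) ∨
    (s'.var 8 = 1 ∧ ∃ r j : ℕ, r < n ∧ j < n ∧ s'.var 10 = r ∧ s'.var 11 = j ∧ s.Cand r j ∧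
      s'.var 9 = s.slack n r j ∧ ∀ r' j', D r' j' → s.Cand r' j' → s'.var 9 ≤ s.slack n r' j')

theorem IsMinSlack.congr {s : State} {n : ℕ} {D D' : ℕ → ℕ → Prop} {s' s'' : State}
    (h : IsMinSlack s n D s') (hD : ∀ r j, D' r j → D r j) (h8 : s''.var 8 = s'.var 8)
    (h9 : s''.var 9 = s'.var 9) (h10 : s''.var 10 = s'.var 10) (h11 : s''.var 11 = s'.var 11) :
    IsMinSlack s n D' s'' := by
  unfold IsMinSlack at *
  rw [h8, h9, h10, h11]
  rcases h with ⟨h1, h2⟩ | ⟨h1, r, j, h2, h3, h4, h5, h6, h7, h8⟩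
  · exact Or.inl ⟨h1, fun r j h => h2 r j (hD r j h)⟩
  · exact Or.inr ⟨h1, r, j, h2, h3, h4, h5, h6, h7, fun r j h => h8 r j (hD r j h)⟩

theorem compareProg_spec {s s' : State} {n r j : ℕ} {D : ℕ → ℕ → Prop}
    (h0 : s'.var 0 = n) (ht : s'.table = s.table) (ha : s'.arr = s.arr) (h3 : s'.var 3 = r)
    (h4 : s'.var 4 = j) (hr : r < n) (hj : j < n) (h : IsMinSlack s n D s') :
    IsMinSlack s n (fun r' j' => D r' j' ∨ (r' = r ∧ j' = j)) (compareProg.run s') := by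
  unfold compareProg
  rw [run_seq]
  have hw := (entryProg_spec h0).1
  have hF := run_frame entryProg s'
  have e3 := hF.1 3 (by decide)
  have e4 := hF.1 4 (by decide)
  have ea : (entryProg.run s').arr = s.arr := by
    rw [← ha]; funext a; exact hF.2 a (by simp [entryProg, writesArr])
  replace h := h.congr (fun _ _ h => h) (hF.1 8 (by decide)) (hF.1 9 (by decide))
    (hF.1 10 (by decide)) (hF.1 11 (by decide))
  generalize entryProg.run s' = s1 at *
  have hsl : slackExpr.eval s1 = s.slack n r j := by
    simp [slackExpr, Expr.eval, hw, e3, e4, h3, h4, ea, State.slack, ht]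
  by_cases hc : s.Cand r j
  · by_cases hlt : s1.var 8 = 1 ∧ s1.var 9 ≤ s.slack n r j
    · rw [run_ite_neg, run_skip]
      · rcases h with ⟨g1, g2⟩ | ⟨g1, r1, j1, g2, g3, g4, g5, g6, g7, g8⟩
        · exact absurd hlt.1 (by rw [g1]; norm_num)
        · refine Or.inr ⟨g1, r1, j1, g2, g3, g4, g5, g6, g7, ?_⟩
          rintro r' j' (hD | ⟨rfl, rfl⟩) hc'
          · exact g8 r' j' hD hc'
          · exact hlt.2
      · simp only [Test.Holds, hsl]
        simp only [Expr.eval]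
        tauto
    · rw [run_ite_pos]
      · refine Or.inr ⟨by simp [Expr.eval], r, j, hr, hj, by simp [Expr.eval, e3, h3],
          by simp [Expr.eval, e4, h4], hc, by simp [hsl], ?_⟩
        have e9 : s.slack n r j = (((assign 9 slackExpr).seq ((assign 10 (.var 3)).seq
          ((assign 11 (.var 4)).seq (assign 8 (.const 1))))).run s1).var 9 := by simp [hsl]
        rw [← e9]
        rintro r' j' (hD | ⟨rfl, rfl⟩) hc'
        · rcases h with ⟨g1, g2⟩ | ⟨g1, r1, j1, g2, g3, g4, g5, g6, g7, g8⟩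
          · exact absurd hc' (g2 _ _ hD)
          · have := g8 r' j' hD hc'
            push Not at hlt
            linarith [hlt g1]
        · exact le_rfl
      · simp only [Test.Holds, hsl]
        simpa [Expr.eval, e3, e4, h3, h4, ea] using
          And.intro (show 1 ≤ s.arr 10 (s.arr 9 r) ∧ ¬ 1 ≤ s.arr 10 j from hc) (not_and.1 hlt)
  · rw [run_ite_neg, run_skip]
    · rcases h with ⟨g1, g2⟩ | ⟨g1, r1, j1, g2, g3, g4, g5, g6, g7, g8⟩
      · refine Or.inl ⟨g1, ?_⟩
        rintro r' j' (hD | ⟨rfl, rfl⟩)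
        · exact g2 r' j' hD
        · exact hc
      · refine Or.inr ⟨g1, r1, j1, g2, g3, g4, g5, g6, g7, ?_⟩
        rintro r' j' (hD | ⟨rfl, rfl⟩) hc'
        · exact g8 r' j' hD hc'
        · exact absurd hc' hc
    · simp only [Test.Holds, Expr.eval, e3, e4, h3, h4, ea]
      exact fun hh => hc hh.1

theorem minSlackProg_spec {s : State} {n : ℕ} (hn : s.var 0 = n)
    (hex : ∃ r j, r < n ∧ j < n ∧ s.Cand r j) :
    ∃ r j : ℕ, r < n ∧ j < n ∧ (minSlackProg.run s).var 10 = r ∧ (minSlackProg.run s).var 11 = j ∧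
      s.Cand r j ∧ (minSlackProg.run s).var 9 = s.slack n r j ∧
      ∀ r' j', r' < n → j' < n → s.Cand r' j' → s.slack n r j ≤ s.slack n r' j' := by
  have key : IsMinSlack s n (fun r j => r < n ∧ j < n) (minSlackProg.run s) := by
    unfold minSlackProg
    rw [run_seq]
    refine run_times (by decide) (n := n) (by simpa using hn)
      (fun k s' => IsMinSlack s n (fun r j => r < k ∧ j < n) s') ?_ ?_
    · exact Or.inl ⟨by simp [Expr.eval], by simp⟩
    · intro k s' hk hx hF hI
      have h0 : s'.var 0 = n := by rw [hF.1 0 (by decide)]; simpa using hn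
      have := run_times (P := compareProg) (x := 4) (by decide) h0
        (fun l s'' => IsMinSlack s n (fun r j => (r < k ∧ j < n) ∨ (r = k ∧ j < l)) s'') ?_ ?_
      · refine this.congr ?_ (by simp) (by simp) (by simp) (by simp)
        rintro r j ⟨h1, h2⟩
        rcases Nat.lt_succ_iff_lt_or_eq.1 h1 with h | h
        · exact Or.inl ⟨h, h2⟩
        · exact Or.inr ⟨h, h2⟩
      · refine hI.congr ?_ (by simp) (by simp) (by simp) (by simp)
        rintro r j (h | h)
        · exact h
        · omega
      · intro l s'' hl hx' hF' hI'
        have h0' : s''.var 0 = n := by rw [hF'.1 0 (by decide), h0]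
        have h2' : s''.var 2 = s.var 2 := by
          rw [hF'.1 2 (by decide), hF.1 2 (by decide)]; simp
        have ha' : s''.arr = s.arr := by
          funext a
          rw [hF'.2 a (by simp [writesArr, compareProg, entryProg]),
            hF.2 a (by simp [writesArr, compareProg, entryProg])]; simp
        have h3' : s''.var 3 = k := by rw [hF'.1 3 (by decide), hx]
        have := compareProg_spec (s := s) (j := l) h0' (by simp only [State.table, h2', ha']) ha'
          h3' hx' hk hl hI'
        refine this.congr ?_ (by simp) (by simp) (by simp) (by simp)
        rintro r j (h | ⟨h1, h2⟩)
        · exact Or.inl (Or.inl h)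
        · rcases Nat.lt_succ_iff_lt_or_eq.1 h2 with h | h
          · exact Or.inl (Or.inr ⟨h1, h⟩)
          · exact Or.inr ⟨h1, h⟩
  rcases key with ⟨-, h⟩ | ⟨-, r, j, h1, h2, h3, h4, h5, h6, h7⟩
  · obtain ⟨r, j, hr, hj, hc⟩ := hex
    exact absurd hc (h r j ⟨hr, hj⟩)
  · exact ⟨r, j, h1, h2, h3, h4, h5, h6, fun r' j' hr hj hc => h6 ▸ h7 r' j' ⟨hr, hj⟩ hc⟩

/-- Changes the dual solution by the least slack. -/
def dualProg : ForProg :=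
  .seq
    (.times 3 (.ite (.le (.const 1) (.get 10 (.get 9 (.var 3))))
      (.put 7 (.var 3) (.add (.get 7 (.var 3)) (.var 9))) .skip))
    (.times 4 (.ite (.le (.const 1) (.get 10 (.var 4)))
      (.put 8 (.var 4) (.sub (.get 8 (.var 4)) (.var 9))) .skip))

theorem dualProg_spec {s : State} {n : ℕ} (hn : s.var 0 = n) :
    (∀ r : ℕ, r < n → (dualProg.run s).arr 7 r =
      if 1 ≤ s.arr 10 (s.arr 9 r) then s.arr 7 r + s.var 9 else s.arr 7 r) ∧
    ∀ j : ℕ, j < n → (dualProg.run s).arr 8 j =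
      if 1 ≤ s.arr 10 j then s.arr 8 j - s.var 9 else s.arr 8 j := by
  unfold dualProg
  constructor
  · intro r hr
    rw [run_seq, run_arr (by decide)]
    refine run_times_map (by decide) hn 7 (fun z => if 1 ≤ s.arr 10 (s.arr 9 z) then
      s.arr 7 z + s.var 9 else s.arr 7 z) ?_ r hr
    intro k s' hk hx hF h7
    have e9 := hF.1 9 (by decide)
    have a9 := hF.2 9 (by decide)
    have a10 := hF.2 10 (by decide)
    by_cases hc : 1 ≤ s.arr 10 (s.arr 9 k)
    · rw [run_ite_pos (by simpa [Test.Holds, Expr.eval, a9, a10, hx] using hc)]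
      simp [Expr.eval, hx, e9, h7, hc]
    · rw [run_ite_neg (by simpa [Test.Holds, Expr.eval, a9, a10, hx] using hc)]
      simp [hc, ← h7]
  · intro r hr
    rw [run_seq]
    have hF0 := run_frame (.times 3 (.ite (.le (.const 1) (.get 10 (.get 9 (.var 3))))
      (.put 7 (.var 3) (.add (.get 7 (.var 3)) (.var 9))) .skip)) s
    generalize ForProg.run (.times 3 (.ite (.le (.const 1) (.get 10 (.get 9 (.var 3))))
      (.put 7 (.var 3) (.add (.get 7 (.var 3)) (.var 9))) .skip)) s = s1 at *
    have f0 := hF0.1 0 (by decide)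
    have f9 := hF0.1 9 (by decide)
    have b8 := hF0.2 8 (by decide)
    have b10 := hF0.2 10 (by decide)
    refine run_times_map (by decide) (f0.trans hn) 8 (fun z => if 1 ≤ s.arr 10 z then
      s.arr 8 z - s.var 9 else s.arr 8 z) ?_ r hr
    intro k s' hk hx hF h7
    have e9 := hF.1 9 (by decide)
    have a10 := hF.2 10 (by decide)
    by_cases hc : 1 ≤ s.arr 10 k
    · rw [run_ite_pos (by simpa [Test.Holds, Expr.eval, a10, b10, hx] using hc)]
      simp [Expr.eval, hx, e9, f9, h7, b8, hc]
    · rw [run_ite_neg (by simpa [Test.Holds, Expr.eval, a10, b10, hx] using hc)]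
      simp [hc, ← b8, ← h7]

/-- Visits the column in variable `11` from the row in variable `10`; variable `12` becomes this
column if it is free, and `-1` otherwise. -/
def visitProg : ForProg :=
  .seq (.put 10 (.var 11) (.add (.var 14) (.const 2))) (.seq (.put 11 (.var 11) (.var 10))
    (.seq (.assign 12 (.var 11))
      (.times 3 (.ite (.eq (.get 9 (.var 3)) (.var 11)) (.assign 12 (.const (-1))) .skip))))

theorem visitProg_spec {s : State} {n : ℕ} (hn : s.var 0 = n) :
    (visitProg.run s).arr 10 = Function.update (s.arr 10) (s.var 11) (s.var 14 + 2) ∧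
    (visitProg.run s).arr 11 = Function.update (s.arr 11) (s.var 11) (s.var 10) ∧
    (((∃ r : ℕ, r < n ∧ s.arr 9 r = s.var 11) ∧ (visitProg.run s).var 12 = -1) ∨
      ((∀ r : ℕ, r < n → s.arr 9 r ≠ s.var 11) ∧ (visitProg.run s).var 12 = s.var 11)) := by
  unfold visitProg
  refine ⟨?_, ?_, ?_⟩
  · simp only [run_seq]
    rw [run_arr (by decide)]
    simp [Expr.eval]
  · simp only [run_seq]
    rw [run_arr (by decide)]
    simp [Expr.eval]
  · simp only [run_seq]
    refine run_times (by decide) (n := n) (by simpa using hn) (fun k s' =>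
      ((∃ r : ℕ, r < k ∧ s.arr 9 r = s.var 11) ∧ s'.var 12 = -1) ∨
      ((∀ r : ℕ, r < k → s.arr 9 r ≠ s.var 11) ∧ s'.var 12 = s.var 11)) ?_ ?_
    · right; simp [Expr.eval]
    · intro k s' hk hx hF hI
      have e11 : s'.var 11 = s.var 11 := by rw [hF.1 11 (by decide)]; simp
      have a9 : s'.arr 9 = s.arr 9 := by rw [hF.2 9 (by decide)]; simp
      by_cases hc : s.arr 9 k = s.var 11
      · rw [run_ite_pos (by simpa [Test.Holds, Expr.eval, a9, e11, hx] using hc)]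
        left
        exact ⟨⟨k, by omega, hc⟩, by simp [Expr.eval]⟩
      · rw [run_ite_neg (by simpa [Test.Holds, Expr.eval, a9, e11, hx] using hc)]
        refine hI.imp ?_ ?_
        · rintro ⟨⟨r, h1, h2⟩, h3⟩
          exact ⟨⟨r, by omega, h2⟩, by simpa using h3⟩
        · rintro ⟨h1, h2⟩
          refine ⟨fun r hr => ?_, by simpa using h2⟩
          rcases Nat.lt_succ_iff_lt_or_eq.1 hr with h | h
          · exact h1 r h
          · rwa [h]

end RAM

namespace RAM

open ForProg Assignment

/-- What is known after `t` rounds of the search that starts in the row `i`. -/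
def SearchInv (W : ℕ → ℕ → ℤ) (n i : ℕ) (μ : ℕ → ℕ) (t : ℕ) (u v vis way : ℤ → ℤ) (found : ℤ) :
    Prop :=
  ∃ w : ℕ → ℕ, (∀ j : ℕ, j < n → 1 ≤ vis j → way j = w j) ∧ Partial W n u v μ ∧
    Tree W n i u v μ vis w ∧ (∀ j : ℕ, j < 2 * n → vis j ≤ t + 1) ∧
    ((found = -1 ∧ (∀ j : ℕ, j < n → 1 ≤ vis j → ∃ r < n, μ r = j) ∧
        t ≤ ((Finset.range n).filter fun j : ℕ => 1 ≤ vis j).card) ∨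
      ∃ c : ℕ, c < n ∧ found = c ∧ 1 ≤ vis c ∧ ∀ r < n, μ r ≠ c)

theorem SearchInv.succ {W : ℕ → ℕ → ℤ} {n i : ℕ} {μ : ℕ → ℕ} {t : ℕ} {u v vis way : ℤ → ℤ}
    {found : ℤ} (h : SearchInv W n i μ t u v vis way found) (hf : found ≠ -1) :
    SearchInv W n i μ (t + 1) u v vis way found := by
  obtain ⟨w, h1, h2, h3, h4, h5⟩ := h
  refine ⟨w, h1, h2, h3, fun j hj => ?_, Or.inr ?_⟩
  · have := h4 j hj; push_cast; omega
  · rcases h5 with h5 | h5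
    · exact absurd h5.1 hf
    · exact h5

/-- One round of the search: visits a new column, unless a free column has been found. -/
def searchStepProg : ForProg :=
  .ite (.eq (.var 12) (.const (-1))) (.seq minSlackProg (.seq dualProg visitProg)) .skip

theorem searchStepProg_spec {s : State} {n i t : ℕ} {μ : ℕ → ℕ} (hn : s.var 0 = n)
    (ht : s.var 14 = t) (hμ : ∀ r : ℕ, r < n → s.arr 9 r = μ r) (hs : Stage n i μ) (hi : i < n)
    (h : SearchInv (fun r j => s.table.weight n r j) n i μ t (s.arr 7) (s.arr 8) (s.arr 10)
      (s.arr 11) (s.var 12)) :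
    SearchInv (fun r j => s.table.weight n r j) n i μ (t + 1) ((searchStepProg.run s).arr 7)
      ((searchStepProg.run s).arr 8) ((searchStepProg.run s).arr 10)
      ((searchStepProg.run s).arr 11) ((searchStepProg.run s).var 12) := by
  unfold searchStepProg
  by_cases hf : s.var 12 = -1
  swap
  · rw [run_ite_neg (by simpa [Test.Holds, Expr.eval] using hf), run_skip]
    exact h.succ hf
  rw [run_ite_pos (by simpa [Test.Holds, Expr.eval] using hf)]
  obtain ⟨w, h1, h2, h3, h4, h5⟩ := h
  replace h5 : (∀ j : ℕ, j < n → 1 ≤ s.arr 10 j → ∃ r < n, μ r = j) ∧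
      t ≤ ((Finset.range n).filter fun j : ℕ => 1 ≤ s.arr 10 j).card := by
    rcases h5 with h5 | ⟨c, -, hc, -⟩
    · exact h5.2
    · rw [hf] at hc; omega
  obtain ⟨hm, hcard⟩ := h5
  have hroot : 1 ≤ s.arr 10 (s.arr 9 i) := by
    rw [hμ i hi, hs.rest i le_rfl hi, h3.root]
  obtain ⟨j0, hj0, hvj0⟩ := exists_not_visited hs hi hm
  obtain ⟨r, j, hr, hj, e10, e11, hc, e9, hmin⟩ :=
    minSlackProg_spec hn ⟨i, j0, hi, hj0, hroot, hvj0⟩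
  simp only [run_seq]
  have hF1 := run_frame minSlackProg s
  generalize minSlackProg.run s = s1 at *
  have a1 : s1.arr = s.arr := by
    funext a; exact hF1.2 a (by simp [minSlackProg, compareProg, entryProg, writesArr])
  have v1 : s1.var 0 = n := (hF1.1 0 (by decide)).trans hn
  have v14 : s1.var 14 = t := (hF1.1 14 (by decide)).trans ht
  obtain ⟨d7, d8⟩ := dualProg_spec v1
  have hF2 := run_frame dualProg s1
  generalize dualProg.run s1 = s2 at *
  have a9 : s2.arr 9 = s.arr 9 := (hF2.2 9 (by decide)).trans (by rw [a1])
  have a10 : s2.arr 10 = s.arr 10 := (hF2.2 10 (by decide)).trans (by rw [a1])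
  have a11 : s2.arr 11 = s.arr 11 := (hF2.2 11 (by decide)).trans (by rw [a1])
  obtain ⟨f10, f11, f12⟩ := visitProg_spec ((hF2.1 0 (by decide)).trans v1)
  have hF3 := run_frame visitProg s2
  generalize visitProg.run s2 = s3 at *
  rw [hF2.1 11 (by decide), e11, hF2.1 14 (by decide), v14, a10] at f10
  rw [hF2.1 11 (by decide), e11, hF2.1 10 (by decide), e10, a11] at f11
  rw [hF2.1 11 (by decide), e11, a9] at f12
  rw [hF3.2 7 (by decide), hF3.2 8 (by decide), f10, f11]
  simp only [a1, e9] at d7 d8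
  obtain ⟨hc1, hc2⟩ := hc
  obtain ⟨P', T'⟩ := dual_update (u' := s2.arr 7) (v' := s2.arr 8) (δ := s.slack n r j) h2 h3
    (fun r' hr' j' hj' g1 g2 => hmin r' j' hr' hj' ⟨by rw [hμ r' hr']; exact g1, g2⟩)
    (by have := h2.feas r hr j hj; simp only [State.slack]; linarith)
    (fun r' hr' => by rw [d7 r' hr', hμ r' hr']) d8
  have hvr : 1 ≤ s.arr 10 (μ r) := by rw [← hμ r hr]; exact hc1
  have htight : s2.arr 7 r + s2.arr 8 j = s.table.weight n r j := by
    rw [d7 r hr, d8 j hj, if_pos hc1, if_neg hc2, State.slack]; ring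
  have T'' := T'.visit hr hj hvr hc2 htight h4 (by omega) hs
  refine ⟨Function.update w j r, ?_, P', T'', ?_, ?_⟩
  · intro j' hj' hv'
    by_cases hjj : j' = j
    · simp [hjj]
    · have hjj' : (j' : ℤ) ≠ j := by omega
      simp only [ne_eq, hjj', not_false_eq_true, Function.update_of_ne, hjj] at hv' ⊢
      exact h1 j' hj' hv'
  · intro j' hj'
    by_cases hjj : j' = j
    · simp [hjj]; omega
    · have hjj' : (j' : ℤ) ≠ j := by omega
      have := h4 j' hj'
      simp only [ne_eq, hjj', not_false_eq_true, Function.update_of_ne]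
      push_cast; omega
  · rcases f12 with ⟨⟨r', hr', hr2⟩, f12⟩ | ⟨hfree, f12⟩
    · left
      refine ⟨f12, ?_, ?_⟩
      · intro j' hj' hv'
        by_cases hjj : j' = j
        · refine ⟨r', hr', ?_⟩
          rw [hμ r' hr'] at hr2
          omega
        · have hjj' : (j' : ℤ) ≠ j := by omega
          simp only [ne_eq, hjj', not_false_eq_true, Function.update_of_ne] at hv'
          exact hm j' hj' hv'
      · have hsub : insert j ((Finset.range n).filter fun j : ℕ => 1 ≤ s.arr 10 j) ⊆
            (Finset.range n).filter fun j' : ℕ =>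
              1 ≤ Function.update (s.arr 10) (j : ℤ) ((t : ℤ) + 2) j' := by
          intro j' hj'
          rcases Finset.mem_insert.1 hj' with rfl | hj'
          · simp [hj]; omega
          · simp only [Finset.mem_filter, Finset.mem_range] at hj' ⊢
            refine ⟨hj'.1, ?_⟩
            have hjj' : (j' : ℤ) ≠ j := by
              intro hh; rw [hh] at hj'; exact hc2 hj'.2
            simpa [hjj'] using hj'.2
        have := Finset.card_le_card hsub
        rw [Finset.card_insert_of_notMem (by simpa using fun _ => not_le.1 hc2)] at this
        omega
    · right
      refine ⟨j, hj, f12, by simp; omega, fun r' hr' hh => hfree r' hr' ?_⟩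
      rw [hμ r' hr', hh]

/-- One step along the alternating path that ends in the column in variable `12`. -/
def augmentStepProg : ForProg :=
  .ite (.le (.var 0) (.var 12)) .skip
    (.seq (.assign 3 (.get 11 (.var 12))) (.seq (.assign 4 (.get 9 (.var 3)))
      (.seq (.put 9 (.var 3) (.var 12)) (.assign 12 (.var 4)))))

/-- What is known after `k` steps along the alternating path. -/
def AugmentInv (W : ℕ → ℕ → ℤ) (n i : ℕ) (u v vis : ℤ → ℤ) (w : ℕ → ℕ) (k : ℕ) (mate : ℤ → ℤ)
    (cur : ℤ) : Prop :=
  ∃ (μ : ℕ → ℕ) (c : ℕ), (∀ r : ℕ, r < n → mate r = μ r) ∧ cur = c ∧ Partial W n u v μ ∧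
    ((n ≤ c ∧ Stage n (i + 1) μ) ∨ (Augmenting W n i u v μ vis w c ∧ vis c + k ≤ n + 1))

theorem augmentStepProg_spec {s : State} {W : ℕ → ℕ → ℤ} {n i k : ℕ} {w : ℕ → ℕ}
    (hn : s.var 0 = n) (hi : i < n) (hw : ∀ j : ℕ, j < n → 1 ≤ s.arr 10 j → s.arr 11 j = w j)
    (h : AugmentInv W n i (s.arr 7) (s.arr 8) (s.arr 10) w k (s.arr 9) (s.var 12)) :
    AugmentInv W n i (s.arr 7) (s.arr 8) (s.arr 10) w (k + 1) ((augmentStepProg.run s).arr 9)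
      ((augmentStepProg.run s).var 12) := by
  obtain ⟨μ, c, hμ, hc, hP, h⟩ := h
  unfold augmentStepProg
  rcases h with ⟨h1, h2⟩ | ⟨h1, h2⟩
  · rw [run_ite_pos (by simpa [Test.Holds, Expr.eval, hn, hc] using h1)]
    exact ⟨μ, c, hμ, hc, hP, Or.inl ⟨h1, h2⟩⟩
  · rw [run_ite_neg (by simpa [Test.Holds, Expr.eval, hn, hc] using h1.lt)]
    obtain ⟨P', h'⟩ := h1.step hP hi
    have hv := h1.visited
    obtain ⟨g1, -⟩ := h1.way_spec c h1.lt (by omega) le_rfl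
    have e11 := hw c h1.lt (by omega)
    refine ⟨Function.update μ (w c) c, μ (w c), ?_, ?_, P', ?_⟩
    · intro r hr
      by_cases hrw : r = w c
      · simp [Expr.eval, hc, e11, hrw]
      · have hrw' : (r : ℤ) ≠ w c := by omega
        simpa [Expr.eval, hc, e11, hrw, hrw'] using hμ r hr
    · simpa [Expr.eval, hc, e11] using hμ _ g1
    · rcases h' with ⟨q1, q2⟩ | ⟨q1, q2⟩
      · exact Or.inl ⟨by omega, q2⟩
      · exact Or.inr ⟨q2, by push_cast; omega⟩

/-- Forgets all visits and visits the own column of the row in variable `13`. -/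
def resetProg : ForProg :=
  .seq (.times 3 (.seq (.put 10 (.var 3) (.const 0))
      (.put 10 (.add (.var 0) (.var 3)) (.const 0))))
    (.seq (.put 10 (.add (.var 0) (.var 13)) (.const 1)) (.assign 12 (.const (-1))))

theorem resetProg_spec {s : State} {n i : ℕ} (hn : s.var 0 = n) (hi : s.var 13 = i) :
    (∀ j : ℕ, j < 2 * n → (resetProg.run s).arr 10 j = if j = n + i then 1 else 0) ∧
      (resetProg.run s).var 12 = -1 := by
  unfold resetProg
  have h := run_times (x := 3) (P := .seq (.put 10 (.var 3) (.const 0))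
      (.put 10 (.add (.var 0) (.var 3)) (.const 0))) (by decide) hn
    (fun k s' => ∀ j : ℕ, j < n → (j < k → s'.arr 10 j = 0 ∧ s'.arr 10 (n + j : ℕ) = 0))
    (by simp) ?_
  · have hF := run_frame (times 3 (.seq (.put 10 (.var 3) (.const 0))
      (.put 10 (.add (.var 0) (.var 3)) (.const 0)))) s
    simp only [run_seq]
    generalize (times 3 (.seq (.put 10 (.var 3) (.const 0))
      (.put 10 (.add (.var 0) (.var 3)) (.const 0)))).run s = s1 at *
    have e0 := (hF.1 0 (by decide)).trans hn
    have e13 := (hF.1 13 (by decide)).trans hi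
    refine ⟨fun j hj => ?_, by simp [Expr.eval]⟩
    have hj0 : s1.arr 10 j = 0 := by
      rcases lt_or_ge j n with hjn | hjn
      · exact (h j hjn hjn).1
      · have := (h (j - n) (by omega) (by omega)).2
        rwa [Nat.add_sub_cancel' hjn] at this
    by_cases hji : j = n + i
    · simp [Expr.eval, e0, e13, hji]
    · have : (j : ℤ) ≠ n + i := by omega
      simp [Expr.eval, e0, e13, hji, this, hj0]
  · intro k s' hk hx hF hI j hj hjk
    have e0 := (hF.1 0 (by decide)).trans hn
    by_cases hjk' : j = k
    · subst hjk'
      simp [Expr.eval, e0, hx, Function.update_apply]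
    · obtain ⟨h1, h2⟩ := hI j hj (by omega)
      have e1 : (j : ℤ) ≠ k := by omega
      have e2 : (j : ℤ) ≠ n + k := by omega
      have e3 : (n : ℤ) + j ≠ k := by omega
      push_cast at h2
      simp [Expr.eval, e0, hx, e1, e2, e3, h1, h2]

/-- Adds the row in variable `13` to the matching. -/
def stageProg : ForProg :=
  .seq resetProg (.seq (.times 14 searchStepProg) (.times 14 augmentStepProg))

/-- The matching in array `9` covers the rows below `i`, with the dual solution in the arrays `7`
and `8`. -/
def StageInv (W : ℕ → ℕ → ℤ) (n i : ℕ) (u v mate : ℤ → ℤ) : Prop :=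
  ∃ μ : ℕ → ℕ, (∀ r : ℕ, r < n → mate r = μ r) ∧ Partial W n u v μ ∧ Stage n i μ

theorem stageProg_spec {s : State} {n i : ℕ} (hn : s.var 0 = n) (hi : s.var 13 = i) (hin : i < n)
    {W : ℕ → ℕ → ℤ} (hW : W = fun r j : ℕ => s.table.weight n r j)
    (h : StageInv W n i (s.arr 7) (s.arr 8) (s.arr 9)) :
    StageInv W n (i + 1) ((stageProg.run s).arr 7) ((stageProg.run s).arr 8)
      ((stageProg.run s).arr 9) := by
  obtain ⟨μ, hμ, hP, hS⟩ := h
  unfold stageProg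
  simp only [run_seq]
  obtain ⟨r10, r12⟩ := resetProg_spec hn hi
  have hF1 := run_frame resetProg s
  generalize resetProg.run s = s1 at *
  have n1 := (hF1.1 0 (by decide)).trans hn
  have t1 : s1.table = s.table := State.table_eq_of_frame hF1 (by decide) (by decide) (by decide)
    (by decide) (by decide) (by decide)
  have a9 := hF1.2 9 (by decide)
  have h1 := run_times (P := searchStepProg) (x := 14) (by decide) n1
    (fun t s' => SearchInv W n i μ t (s'.arr 7) (s'.arr 8) (s'.arr 10) (s'.arr 11) (s'.var 12))
    ?_ ?_
  rotate_left
  · have hz : ∀ j : ℕ, j < 2 * n → j ≠ n + i → s1.arr 10 j = 0 := fun j hj hne => by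
      rw [r10 j hj, if_neg hne]
    refine ⟨fun _ => 0, ?_, ?_, ⟨?_, ?_, ?_, ?_⟩, ?_, Or.inl ⟨by simpa using r12, ?_, by simp⟩⟩ <;>
      simp only [State.setVar_arr]
    · intro j hj hv
      rw [hz j (by omega) (by omega)] at hv; omega
    · rw [hF1.2 7 (by decide), hF1.2 8 (by decide)]; exact hP
    · rw [r10 _ (by omega), if_pos rfl]
    · exact fun j _ hj hne => hz j hj hne
    · exact fun j hj => Or.inl (hz j (by omega) (by omega))
    · intro j hj hv
      rw [hz j (by omega) (by omega)] at hv; omega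
    · intro j hj
      rw [r10 j hj]; split_ifs <;> simp
    · intro j hj hv
      rw [hz j (by omega) (by omega)] at hv; omega
  · intro t s' ht hx hF hI
    have hn' := (hF.1 0 (by decide)).trans n1
    have ht' : s'.table = s.table := by
      rw [← t1]
      exact State.table_eq_of_frame hF (by decide) (by decide) (by decide) (by decide) (by decide)
        (by decide)
    have hμ' : ∀ r : ℕ, r < n → s'.arr 9 r = μ r := fun r hr => by
      rw [hF.2 9 (by decide), a9, hμ r hr]
    rw [hW, ← ht'] at hI
    have := searchStepProg_spec hn' hx hμ' hS hin hI
    rw [hW, ← ht']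
    simpa using this
  have hF2 := run_frame (times 14 searchStepProg) s1
  generalize (times 14 searchStepProg).run s1 = s2 at *
  obtain ⟨w, hw, hP2, hT2, hbd, hfound⟩ := h1
  have n2 := (hF2.1 0 (by decide)).trans n1
  have hμ2 : ∀ r : ℕ, r < n → s2.arr 9 r = μ r := fun r hr => by
    rw [hF2.2 9 (by decide), a9, hμ r hr]
  obtain ⟨c, hc, h12, hvc, hfree⟩ : ∃ c : ℕ, c < n ∧ s2.var 12 = c ∧ 1 ≤ s2.arr 10 c ∧
      ∀ r < n, μ r ≠ c := by
    rcases hfound with ⟨-, hm, hcard⟩ | h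
    · obtain ⟨j, hj, hvj⟩ := exists_not_visited hS hin hm
      have := Finset.eq_of_subset_of_card_le (Finset.filter_subset _ _)
        ((Finset.card_range n).le.trans hcard)
      have hj' := Finset.mem_range.2 hj
      rw [← this] at hj'
      exact absurd (Finset.mem_filter.1 hj').2 hvj
    · exact h
  have h3 := run_times (P := augmentStepProg) (x := 14) (by decide) n2
    (fun k s' => AugmentInv W n i (s2.arr 7) (s2.arr 8) (s2.arr 10) w k (s'.arr 9) (s'.var 12))
    ?_ ?_
  rotate_left
  · refine ⟨μ, c, hμ2, by simpa using h12, hP2, Or.inr ⟨hT2.augmenting hS hc hvc hfree, ?_⟩⟩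
    have := hbd c (by omega)
    push_cast; omega
  · intro k s' hk hx hF hI
    have a7 := hF.2 7 (by decide)
    have a8 := hF.2 8 (by decide)
    have a10 := hF.2 10 (by decide)
    have a11 := hF.2 11 (by decide)
    have := augmentStepProg_spec (s := s') (W := W) (n := n) (i := i) (k := k) (w := w)
      ((hF.1 0 (by decide)).trans n2) hin (by rw [a10, a11]; exact hw)
      (by rw [a7, a8, a10]; exact hI)
    rw [a7, a8, a10] at this
    simpa using this
  have hF3 := run_frame (times 14 augmentStepProg) s2
  generalize (times 14 augmentStepProg).run s2 = s3 at *
  rw [hF3.2 7 (by decide), hF3.2 8 (by decide)]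
  obtain ⟨μ', c', g1, -, g2, g3⟩ := h3
  refine ⟨μ', g1, g2, ?_⟩
  rcases g3 with ⟨-, g3⟩ | ⟨g3, g4⟩
  · exact g3
  · have := g3.visited
    omega

/-- The Hungarian algorithm. -/
def hungarianProg : ForProg :=
  .seq (.times 3 (.seq (.put 7 (.var 3) (.sub (.const 0) (.var 2)))
      (.seq (.put 8 (.var 3) (.const 0)) (.put 9 (.var 3) (.add (.var 0) (.var 3))))))
    (.times 13 stageProg)

theorem hungarianProg_spec {s : State} {n : ℕ} (hn : s.var 0 = n)
    (hbd : ∀ r j : ℕ, -s.var 2 ≤ s.table.weight n r j) :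
    ∃ μ : ℕ → ℕ, (∀ r : ℕ, r < n → (hungarianProg.run s).arr 9 r = μ r) ∧ (∀ r < n, μ r < n) ∧
      (∀ r < n, ∀ r' < n, μ r = μ r' → r = r') ∧
      ∀ τ : ℕ → ℕ, (∀ r < n, τ r < n) → (∀ r < n, ∀ r' < n, τ r = τ r' → r = r') →
        ∑ r ∈ Finset.range n, s.table.weight n r (μ r) ≤
          ∑ r ∈ Finset.range n, s.table.weight n r (τ r) := by
  unfold hungarianProg
  simp only [run_seq]
  have h := run_times (x := 3) (P := .seq (.put 7 (.var 3) (.sub (.const 0) (.var 2)))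
      (.seq (.put 8 (.var 3) (.const 0)) (.put 9 (.var 3) (.add (.var 0) (.var 3)))))
    (by decide) hn (fun k s' => ∀ r : ℕ, r < k → s'.arr 7 r = -s.var 2 ∧ s'.arr 8 r = 0 ∧
      s'.arr 9 r = (n + r : ℕ)) (by simp) ?_
  rotate_left
  · intro k s' hk hx hF hI r hr
    have e0 := (hF.1 0 (by decide)).trans hn
    have e2 := hF.1 2 (by decide)
    by_cases hrk : r = k
    · subst hrk
      simp [Expr.eval, e0, e2, hx]
    · have hrk' : (r : ℤ) ≠ k := by omega
      simpa [Expr.eval, e0, e2, hx, hrk'] using hI r (by omega)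
  have hF1 := run_frame (times 3 (.seq (.put 7 (.var 3) (.sub (.const 0) (.var 2)))
      (.seq (.put 8 (.var 3) (.const 0)) (.put 9 (.var 3) (.add (.var 0) (.var 3)))))) s
  generalize (times 3 (.seq (.put 7 (.var 3) (.sub (.const 0) (.var 2)))
      (.seq (.put 8 (.var 3) (.const 0)) (.put 9 (.var 3) (.add (.var 0) (.var 3)))))).run s = s1
    at *
  have n1 := (hF1.1 0 (by decide)).trans hn
  have t1 : s1.table = s.table := State.table_eq_of_frame hF1 (by decide) (by decide) (by decide)
    (by decide) (by decide) (by decide)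
  have h2 := run_times (P := stageProg) (x := 13) (by decide) n1
    (fun i s' => StageInv (fun r j : ℕ => s.table.weight n r j) n i (s'.arr 7) (s'.arr 8)
      (s'.arr 9)) ?_ ?_
  rotate_left
  · refine ⟨fun r => n + r, fun r hr => (h r hr).2.2, ⟨?_, ?_, ?_⟩, ⟨?_, ?_⟩⟩
    · intros; omega
    · intro r hr j hj
      simp only [State.setVar_arr]
      rw [(h r hr).1, (h j hj).2.1]
      simpa using hbd r j
    · intros; omega
    · intros; omega
    · intros; rfl
  · intro i s' hi hx hF hI
    have ht' : s'.table = s.table := by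
      rw [← t1]
      exact State.table_eq_of_frame hF (by decide) (by decide) (by decide) (by decide) (by decide)
        (by decide)
    have := stageProg_spec ((hF.1 0 (by decide)).trans n1) hx hi (by rw [ht']) hI
    simpa using this
  obtain ⟨μ, h3, h4, h5⟩ := h2
  exact ⟨μ, h3, h5.done, h4.inj, fun τ g1 g2 => h4.sum_le h5.done g1 g2⟩

end RAM

namespace RAM.ForProg

/-- Runs `P` for `x = 0, 1, …` below the value of the variable `y`. -/
def upto (x y : ℕ) (P : ForProg) : ForProg :=
  .times x (.ite (.le (.add (.var x) (.const 1)) (.var y)) P .skip)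

theorem run_upto {P : ForProg} {x y : ℕ} (hwf : (upto x y P).wf = true)
    (hy : y ∉ (upto x y P).writes) {s : State} {n m : ℕ} (hn : s.var 0 = n) (hm : s.var y = m)
    (hmn : m ≤ n) (Inv : ℕ → State → Prop) (h0 : Inv 0 (s.setVar x 0))
    (hx : ∀ s' z, Inv m s' → Inv m (s'.setVar x z))
    (hs : ∀ (k : ℕ) (s' : State), k < m → s'.var x = k →
      Frame (upto x y P).writes (upto x y P).writesArr s s' →
      Inv k s' → Inv (k + 1) ((P.run s').setVar x (k + 1))) :
    Inv m ((upto x y P).run s) := by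
  have := run_times hwf hn (fun k s' => Inv (min k m) s') (by simpa using h0) ?_
  · rwa [min_eq_right hmn] at this
  · intro k s' hk hxk hF hI
    have hy' := (hF.1 y hy).trans hm
    by_cases hkm : k < m
    · rw [run_ite_pos (by simp only [Test.Holds, Expr.eval, hxk, hy']; omega),
        min_eq_left (by omega)]
      rw [min_eq_left (by omega)] at hI
      exact hs k s' hkm hxk hF hI
    · rw [run_ite_neg (by simp only [Test.Holds, Expr.eval, hxk, hy']; omega), run_skip,
        min_eq_right (by omega)]
      rw [min_eq_right (by omega)] at hI
      exact hx _ _ hI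

end RAM.ForProg

theorem List.getD_flatMap {α β : Type*} (l : List α) (f : α → List β) (i k : ℕ) (d : β)
    (hi : i < l.length) (hk : k < (f l[i]).length) :
    (l.flatMap f).getD (((l.take i).flatMap f).length + k) d = (f l[i]).getD k d := by
  conv_lhs =>
    rw [← List.take_append_drop i l, ← List.cons_getElem_drop_succ (h := hi)]
  rw [List.flatMap_append, List.flatMap_cons, List.getD_append_right _ _ _ _ (by simp),
    List.getD_append _ _ _ _ (by simpa using hk)]
  simp

namespace RIS

open RAM

variable (I : RIS)

theorem Item.ext_val {I : RIS} {a b : I.Item} (h1 : (a.1 : ℕ) = b.1) (h2 : (a.2 : ℕ) = b.2) :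
    a = b := by
  obtain ⟨⟨i, hi⟩, k⟩ := a
  obtain ⟨⟨i', hi'⟩, k'⟩ := b
  obtain rfl : i = i' := h1
  exact congrArg (Sigma.mk _) (Fin.ext h2)

/-! ### Positions in the input -/

/-- The part of the input that describes the `i`-th set. -/
def block (i : Fin I.m) : List ℤ := [(I.r i : ℤ), (I.p i : ℤ)] ++ List.ofFn (I.c i)

/-- The position of the `i`-th block in the input. -/
def off (i : ℕ) : ℕ := 1 + (((List.finRange I.m).take i).flatMap I.block).length

/-- The position of the cost of an item in the input. -/
def pos (a : I.Item) : ℕ := I.off a.1 + 2 + a.2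

/-- The length of the input. -/
abbrev len : ℕ := I.encode.length

/-- The input array. -/
def inp : ℤ → ℤ := (State.init I.encode).arr 0

theorem length_block (i : Fin I.m) : (I.block i).length = I.r i + 2 := by simp [block]

theorem off_zero : I.off 0 = 1 := by simp [off]

theorem off_succ (i : Fin I.m) : I.off (i + 1) = I.off i + 2 + I.r i := by
  have : (List.finRange I.m).take (i + 1) = (List.finRange I.m).take i ++ [i] := by
    rw [List.take_succ_eq_append_getElem (by simp)]; simp
  rw [off, this, List.flatMap_append, List.length_append, off]
  simp only [List.flatMap_cons, List.flatMap_nil, List.append_nil, length_block]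
  omega

theorem encode_eq : I.encode = (I.m : ℤ) :: ((List.finRange I.m).flatMap I.block ++
    ((I.T.length : ℤ) :: I.T.flatMap (fun t => I.encodeItem t.1 ++ I.encodeItem t.2))) := by
  simp [encode]
  rfl

theorem length_take_pairs (t : ℕ) (ht : t ≤ I.T.length) :
    ((I.T.take t).flatMap (fun t => I.encodeItem t.1 ++ I.encodeItem t.2)).length = 4 * t := by
  simp [List.length_flatMap, encodeItem, min_eq_left ht, mul_comm]

theorem off_m : I.off I.m = 1 + ((List.finRange I.m).flatMap I.block).length := by
  rw [off, List.take_of_length_le (by simp)]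

theorem len_eq : I.len = I.off I.m + 1 + 4 * I.T.length := by
  have := I.length_take_pairs I.T.length le_rfl
  rw [List.take_length] at this
  rw [len, encode_eq, List.length_cons, List.length_append, List.length_cons, this, off_m]
  omega

theorem off_add_le {i j : ℕ} (hi : i < I.m) (hij : i < j) (hj : j ≤ I.m) :
    I.off i + 2 + I.r ⟨i, hi⟩ ≤ I.off j := by
  induction j with
  | zero => omega
  | succ j ih =>
    have h := I.off_succ ⟨j, by omega⟩
    simp only at h
    rcases Nat.lt_succ_iff_lt_or_eq.1 hij with h' | rfl
    · have := ih h' (by omega); omega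
    · exact h.ge

theorem pos_injective : Function.Injective I.pos := by
  intro a b h
  unfold pos at h
  have ha := a.2.2
  have hb := b.2.2
  rcases lt_trichotomy (a.1 : ℕ) b.1 with hlt | heq | hgt
  · have := I.off_add_le a.1.2 hlt b.1.2.le
    simp only [Fin.eta] at this; omega
  · rw [heq] at h
    exact Item.ext_val heq (by omega)
  · have := I.off_add_le b.1.2 hgt a.1.2.le
    simp only [Fin.eta] at this; omega

theorem pos_lt_off (a : I.Item) : I.pos a < I.off I.m := by
  have h := I.off_add_le a.1.2 a.1.2 le_rfl
  have := a.2.2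
  simp only [Fin.eta] at h
  unfold pos; omega

theorem pos_lt (a : I.Item) : I.pos a < I.len := by
  have := I.pos_lt_off a
  rw [len_eq]; omega

theorem m_le_len : I.m ≤ I.len := by
  have : ∀ i ≤ I.m, i ≤ I.off i := by
    intro i
    induction i with
    | zero => intro _; omega
    | succ i ih =>
      intro hi
      have h1 := I.off_succ ⟨i, by omega⟩
      have h2 := ih (by omega)
      simp only at h1; omega
  have := this _ le_rfl
  rw [len_eq]; omega

theorem r_le_len (i : Fin I.m) : I.r i ≤ I.len := by
  have := I.off_add_le i.2 i.2 le_rfl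
  simp only [Fin.eta] at this
  rw [len_eq]; omega

theorem inp_natCast (j : ℕ) : I.inp j = I.encode.getD j 0 := by simp [inp, State.init]

theorem inp_zero : I.inp 0 = I.m := by
  have := I.inp_natCast 0
  simpa [encode_eq] using this

theorem inp_block (i : Fin I.m) {k : ℕ} (hk : k < I.r i + 2) :
    I.inp ((I.off i + k : ℕ) : ℤ) = (I.block i).getD k 0 := by
  have h := List.getD_flatMap (List.finRange I.m) I.block i k 0 (by simp)
    (by simpa [length_block] using hk)
  simp only [List.getElem_finRange, Fin.cast_mk, Fin.eta] at h
  rw [inp_natCast, encode_eq, off, show ∀ x : ℕ, 1 + x + k = (x + k) + 1 by intro x; omega,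
    List.getD_cons_succ, ← h]
  have h2 := I.off_add_le i.2 i.2 le_rfl
  rw [off_m, off] at h2
  simp only [Fin.eta] at h2
  exact List.getD_append _ _ _ _ (by omega)

theorem inp_r (i : Fin I.m) : I.inp (I.off i) = I.r i := by
  simpa [block] using I.inp_block i (k := 0) (by omega)

theorem inp_p (i : Fin I.m) : I.inp (I.off i + 1) = I.p i := by
  simpa [block] using I.inp_block i (k := 1) (by omega)

theorem inp_pos (a : I.Item) : I.inp (I.pos a) = I.c a.1 a.2 := by
  have := I.inp_block a.1 (k := a.2 + 2) (by have := a.2.2; omega)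
  rw [show I.off a.1 + (a.2 + 2) = I.pos a by unfold pos; omega] at this
  rw [this]
  simp [block]

theorem inp_off_m : I.inp (I.off I.m) = I.T.length := by
  rw [inp_natCast, encode_eq, off_m, add_comm, List.getD_cons_succ,
    List.getD_append_right _ _ _ _ le_rfl]
  simp

theorem inp_pair {t : ℕ} (ht : t < I.T.length) {k : ℕ} (hk : k < 4) :
    I.inp ((I.off I.m + 1 + 4 * t + k : ℕ) : ℤ) =
      (I.encodeItem I.T[t].1 ++ I.encodeItem I.T[t].2).getD k 0 := by
  have h := List.getD_flatMap I.T (fun t => I.encodeItem t.1 ++ I.encodeItem t.2) t k 0 ht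
    (by simpa [encodeItem] using hk)
  rw [I.length_take_pairs t ht.le] at h
  rw [← h, inp_natCast, encode_eq, off_m,
    show ∀ x : ℕ, 1 + x + 1 + 4 * t + k = (x + (4 * t + k + 1)) + 1 by intro x; omega,
    List.getD_cons_succ, List.getD_append_right _ _ _ _ (by omega)]
  simp

/-! ### Reading the item sets -/

variable {I}

/-- The array `f` holds `i + 1` at the positions of the items in `D` of the `i`-th set, and `0`
elsewhere. -/
def Marked (D : Set I.Item) (f : ℤ → ℤ) : Prop :=
  (∀ a ∈ D, f (I.pos a) = (a.1 : ℕ) + 1) ∧ ∀ q, f q ≠ 0 → ∃ a ∈ D, q = I.pos a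

theorem Marked.insert {D D' : Set I.Item} {f : ℤ → ℤ} (h : Marked D f) (a : I.Item)
    (hD : ∀ b, b ∈ D' ↔ b = a ∨ b ∈ D) :
    Marked D' (Function.update f (I.pos a) ((a.1 : ℕ) + 1)) := by
  constructor
  · intro b hb
    by_cases hba : b = a
    · simp [hba]
    · have : (I.pos b : ℤ) ≠ I.pos a := fun hc => hba (I.pos_injective (by exact_mod_cast hc))
      simpa [this] using h.1 b (((hD b).1 hb).resolve_left hba)
  · intro q hq
    by_cases hqa : q = I.pos a
    · exact ⟨a, (hD a).2 (Or.inl rfl), hqa⟩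
    · simp only [ne_eq, hqa, not_false_eq_true, Function.update_of_ne] at hq
      obtain ⟨b, hb, rfl⟩ := h.2 q hq
      exact ⟨b, (hD b).2 (Or.inr hb), rfl⟩

theorem Marked.congr {D D' : Set I.Item} {f : ℤ → ℤ} (h : Marked D f)
    (hD : ∀ b, b ∈ D' ↔ b ∈ D) : Marked D' f := by
  rwa [show D' = D from Set.ext hD]

/-- The items of the first `i` sets and the first `k` items of the next set. -/
def before (I : RIS) (i k : ℕ) : Set I.Item :=
  {a | (a.1 : ℕ) < i ∨ (a.1 : ℕ) = i ∧ (a.2 : ℕ) < k}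

/-- The first `p i` items of each set; they stand for the items to be selected. -/
def slots (I : RIS) : Set I.Item := {a | (a.2 : ℕ) < I.p a.1}

/-- Marks one item. -/
def markProg : ForProg :=
  .seq (.put 3 (.add (.var 16) (.var 14)) (.add (.var 13) (.const 1)))
    (.ite (.le (.add (.var 14) (.const 1)) (.var 18))
      (.put 4 (.add (.var 16) (.var 14)) (.add (.var 13) (.const 1))) .skip)

/-- Reads the description of one set. -/
def readSetProg : ForProg :=
  .seq (.assign 17 (.get 0 (.var 16))) (.seq (.assign 18 (.get 0 (.add (.var 16) (.const 1))))
    (.seq (.assign 16 (.add (.var 16) (.const 2))) (.seq (.put 2 (.var 13) (.var 16))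
      (.seq (.upto 14 17 markProg) (.assign 16 (.add (.var 16) (.var 17)))))))

open ForProg

theorem markProg_spec {s : State} (a : I.Item) (h16 : s.var 16 = I.off a.1 + 2)
    (h14 : s.var 14 = (a.2 : ℕ)) (h13 : s.var 13 = (a.1 : ℕ)) (h18 : s.var 18 = I.p a.1)
    (h3 : Marked (I.before a.1 a.2) (s.arr 3)) (h4 : Marked (I.before a.1 a.2 ∩ I.slots) (s.arr 4)) :
    Marked (I.before a.1 (a.2 + 1)) ((markProg.run s).arr 3) ∧
      Marked (I.before a.1 (a.2 + 1) ∩ I.slots) ((markProg.run s).arr 4) := by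
  have hset : ∀ b, b ∈ I.before a.1 (a.2 + 1) ↔ b = a ∨ b ∈ I.before a.1 a.2 := by
    intro b
    simp only [before, Set.mem_ofPred_eq]
    constructor
    · rintro (h | ⟨h1, h2⟩)
      · exact Or.inr (Or.inl h)
      · rcases Nat.lt_succ_iff_lt_or_eq.1 h2 with h | h
        · exact Or.inr (Or.inr ⟨h1, h⟩)
        · exact Or.inl (Item.ext_val h1 h)
    · rintro (rfl | h | ⟨h1, h2⟩)
      · right; omega
      · exact Or.inl h
      · exact Or.inr ⟨h1, by omega⟩
  have hpos : s.var 16 + s.var 14 = (I.pos a : ℤ) := by rw [h16, h14, pos]; push_cast; ring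
  unfold markProg
  rw [run_seq]
  constructor
  · have : ∀ s' : State, (ForProg.run (.ite (.le (.add (.var 14) (.const 1)) (.var 18))
      (.put 4 (.add (.var 16) (.var 14)) (.add (.var 13) (.const 1))) .skip) s').arr 3 = s'.arr 3 :=
      fun s' => run_arr (by decide) s'
    rw [this]
    simpa [Expr.eval, hpos, h13] using h3.insert a hset
  · by_cases hp : (a.2 : ℕ) < I.p a.1
    · rw [run_ite_pos (by simp [Test.Holds, Expr.eval, h14, h18]; omega)]
      have := h4.insert (D' := I.before a.1 (a.2 + 1) ∩ I.slots) a (fun b => by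
        simp only [Set.mem_inter_iff, hset]
        constructor
        · rintro ⟨h1 | h1, h2⟩
          · exact Or.inl h1
          · exact Or.inr ⟨h1, h2⟩
        · rintro (rfl | ⟨h1, h2⟩)
          · exact ⟨Or.inl rfl, hp⟩
          · exact ⟨Or.inr h1, h2⟩)
      simpa [Expr.eval, hpos, h13] using this
    · rw [run_ite_neg (by simp [Test.Holds, Expr.eval, h14, h18]; omega), run_skip]
      refine Marked.congr (f := s.arr 4) h4 fun b => ?_
      simp only [Set.mem_inter_iff, hset]
      constructor
      · rintro ⟨rfl | h1, h2⟩
        · exact absurd h2 hp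
        · exact ⟨h1, h2⟩
      · rintro ⟨h1, h2⟩
        exact ⟨Or.inr h1, h2⟩

/-- What is known after `i` sets have been read. -/
def ReadInv (I : RIS) (i : ℕ) (s : State) : Prop :=
  s.var 16 = I.off i ∧ (∀ j : ℕ, j < i → s.arr 2 j = I.off j + 2) ∧
    Marked (I.before i 0) (s.arr 3) ∧ Marked (I.before i 0 ∩ I.slots) (s.arr 4)

theorem readSetProg_spec {s : State} (i : Fin I.m) (h0 : s.var 0 = I.len)
    (ha : s.arr 0 = I.inp) (h13 : s.var 13 = (i : ℕ)) (h : ReadInv I i s) :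
    ReadInv I (i + 1) (readSetProg.run s) := by
  obtain ⟨h16, h2, h3, h4⟩ := h
  unfold readSetProg
  simp only [run_seq]
  set s1 := (ForProg.put 2 (.var 13) (.var 16)).run
    ((ForProg.assign 16 (.add (.var 16) (.const 2))).run
      ((ForProg.assign 18 (.get 0 (.add (.var 16) (.const 1)))).run
        ((ForProg.assign 17 (.get 0 (.var 16))).run s))) with hs1
  have e16 : s1.var 16 = I.off i + 2 := by simp [hs1, Expr.eval, h16]
  have e17 : s1.var 17 = I.r i := by simp [hs1, Expr.eval, h16, ha, inp_r]
  have e18 : s1.var 18 = I.p i := by simp [hs1, Expr.eval, h16, ha, inp_p]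
  have e13 : s1.var 13 = (i : ℕ) := by simp [hs1, h13]
  have e0 : s1.var 0 = I.len := by simp [hs1, h0]
  have a2 : s1.arr 2 = Function.update (s.arr 2) (i : ℕ) (I.off i + 2) := by
    simp [hs1, Expr.eval, h16, h13]
  have a3 : s1.arr 3 = s.arr 3 := by simp [hs1]
  have a4 : s1.arr 4 = s.arr 4 := by simp [hs1]
  clear_value s1
  have key := run_upto (x := 14) (y := 17) (P := markProg) (by decide) (by decide) e0 e17
    (I.r_le_len i) (fun k s' => Marked (I.before i k) (s'.arr 3) ∧
      Marked (I.before i k ∩ I.slots) (s'.arr 4)) ?_ ?_ ?_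
  rotate_left
  · simpa [a3, a4] using And.intro h3 h4
  · intro s' z h; simpa using h
  · intro k s' hk hx hF hI
    exact markProg_spec ⟨i, ⟨k, hk⟩⟩ ((hF.1 16 (by decide)).trans e16) hx
      ((hF.1 13 (by decide)).trans e13) ((hF.1 18 (by decide)).trans e18) hI.1 hI.2
  have hF := run_frame (upto 14 17 markProg) s1
  generalize (upto 14 17 markProg).run s1 = s2 at *
  have hset : ∀ b, b ∈ I.before (i + 1) 0 ↔ b ∈ I.before i (I.r i) := by
    intro b
    simp only [before, Set.mem_ofPred_eq]
    constructor
    · rintro (h | h)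
      · rcases Nat.lt_succ_iff_lt_or_eq.1 h with h | h
        · exact Or.inl h
        · right
          have := b.2.2
          have hb : I.r b.1 = I.r i := congrArg I.r (Fin.ext h)
          exact ⟨h, by omega⟩
      · omega
    · rintro (h | h) <;> left <;> omega
  refine ⟨?_, ?_, ?_, ?_⟩
  · simp [Expr.eval, hF.1 16 (by decide), hF.1 17 (by decide), e16, e17, off_succ]
  · intro j hj
    simp only [run_assign, State.setVar_arr, hF.2 2 (by decide), a2]
    by_cases hji : j = i
    · simp [hji]
    · have : (j : ℤ) ≠ (i : ℕ) := by omega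
      rw [Function.update_of_ne this]
      exact h2 j (by omega)
  · exact key.1.congr hset
  · exact key.2.congr fun b => by simp only [Set.mem_inter_iff, hset]

/-- Reads the descriptions of all sets. -/
def readSetsProg : ForProg :=
  .seq (.assign 1 (.get 0 (.const 0))) (.seq (.assign 16 (.const 1)) (.upto 13 1 readSetProg))

theorem readSetsProg_spec {s : State} (h0 : s.var 0 = I.len) (ha : s.arr 0 = I.inp)
    (h3 : s.arr 3 = fun _ => 0) (h4 : s.arr 4 = fun _ => 0) :
    (readSetsProg.run s).var 1 = I.m ∧ (readSetsProg.run s).var 16 = I.off I.m ∧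
      (∀ i : Fin I.m, (readSetsProg.run s).arr 2 (i : ℕ) = I.off i + 2) ∧
      Marked (Set.univ : Set I.Item) ((readSetsProg.run s).arr 3) ∧ Marked I.slots ((readSetsProg.run s).arr 4) := by
  unfold readSetsProg
  simp only [run_seq]
  set s1 := (ForProg.assign 16 (.const 1)).run ((ForProg.assign 1 (.get 0 (.const 0))).run s)
    with hs1
  have e1 : s1.var 1 = I.m := by simp [hs1, Expr.eval, ha, inp_zero]
  have e0 : s1.var 0 = I.len := by simp [hs1, h0]
  have key := run_upto (x := 13) (y := 1) (P := readSetProg) (by decide) (by decide) e0 e1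
    I.m_le_len (ReadInv I) ?_ ?_ ?_
  rotate_left
  · refine ⟨by simp [hs1, Expr.eval, off_zero], by omega, ?_, ?_⟩ <;>
      simp [hs1, h3, h4, Marked, before]
  · intro s' z h; simpa [ReadInv] using h
  · intro k s' hk hx hF hI
    have := readSetProg_spec ⟨k, hk⟩ ((hF.1 0 (by decide)).trans e0)
      ((hF.2 0 (by decide)).trans (by simp [hs1, ha])) hx hI
    simpa [ReadInv] using this
  have hF := run_frame (upto 13 1 readSetProg) s1
  obtain ⟨h16, h2, h3, h4⟩ := key
  refine ⟨(hF.1 1 (by decide)).trans e1, h16, fun i => h2 i i.2, h3.congr fun b => ?_,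
    h4.congr fun b => ?_⟩ <;> simp [before]

end RIS

namespace RIS

open RAM ForProg

variable {I : RIS}

/-! ### Reading the forbidden pairs -/

/-- At the position of an item `a`, the array `f` holds the first position of an item `b` with
`L a b`. -/
def RepOf (L : I.Item → I.Item → Prop) (f : ℤ → ℤ) : Prop :=
  ∀ a, (∃ b, L a b ∧ f (I.pos a) = I.pos b) ∧ ∀ b, L a b → f (I.pos a) ≤ I.pos b

/-- One entry of the array `5` is lowered to the value of the variable `y`. -/
def lowerProg (x y : ℕ) : ForProg :=
  .ite (.le (.get 5 (.var x)) (.var y)) .skip (.put 5 (.var x) (.var y))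

theorem lowerProg_spec {L L' : I.Item → I.Item → Prop} {s : State} {x y : ℕ} {a b : I.Item}
    (hx : s.var x = I.pos a) (hy : s.var y = I.pos b) (h : RepOf L (s.arr 5))
    (hL : ∀ c d, L' c d ↔ L c d ∨ (c = a ∧ d = b)) : RepOf L' (((lowerProg x y).run s).arr 5) := by
  unfold lowerProg
  by_cases hle : s.arr 5 (I.pos a) ≤ I.pos b
  · rw [run_ite_pos (by simpa [Test.Holds, Expr.eval, hx, hy] using hle), run_skip]
    intro c
    obtain ⟨⟨d, h1, h2⟩, h3⟩ := h c
    refine ⟨⟨d, (hL c d).2 (Or.inl h1), h2⟩, fun e he => ?_⟩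
    rcases (hL c e).1 he with h4 | ⟨rfl, rfl⟩
    · exact h3 e h4
    · exact hle
  · rw [run_ite_neg (by simpa [Test.Holds, Expr.eval, hx, hy] using hle)]
    intro c
    obtain ⟨⟨d, h1, h2⟩, h3⟩ := h c
    by_cases hca : c = a
    · subst hca
      simp only [run_put, Expr.eval, hx, hy, State.setArr_arr, if_true, Function.update_self]
      refine ⟨⟨b, (hL c b).2 (Or.inr ⟨rfl, rfl⟩), rfl⟩, fun e he => ?_⟩
      rcases (hL c e).1 he with h4 | ⟨-, rfl⟩
      · exact (not_le.1 hle).le.trans (h3 e h4)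
      · exact le_rfl
    · have : (I.pos c : ℤ) ≠ I.pos a := fun hc => hca (I.pos_injective (by exact_mod_cast hc))
      simp only [run_put, Expr.eval, hx, hy, State.setArr_arr, if_true, ne_eq, this,
        not_false_eq_true, Function.update_of_ne]
      refine ⟨⟨d, (hL c d).2 (Or.inl h1), h2⟩, fun e he => ?_⟩
      rcases (hL c e).1 he with h4 | ⟨h4, -⟩
      · exact h3 e h4
      · exact absurd h4 hca

/-- The array `f` is `0` exactly at the positions of the items `a` with `(a, a)` not in `T`. -/
def BadOf (T : List (I.Item × I.Item)) (f : ℤ → ℤ) : Prop :=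
  ∀ a, f (I.pos a) = 0 ↔ (a, a) ∉ T

/-- Excludes an item that is forbidden together with itself. -/
def excludeProg : ForProg :=
  .ite (.eq (.var 3) (.var 4)) (.put 6 (.var 3) (.const 1)) .skip

theorem excludeProg_spec {T : List (I.Item × I.Item)} {s : State} {a b : I.Item}
    (hx : s.var 3 = I.pos a) (hy : s.var 4 = I.pos b) (h : BadOf T (s.arr 6)) :
    BadOf (T ++ [(a, b)]) ((excludeProg.run s).arr 6) := by
  unfold excludeProg
  by_cases hab : a = b
  · subst hab
    rw [run_ite_pos (by simp [Test.Holds, Expr.eval, hx, hy])]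
    intro c
    by_cases hca : c = a
    · subst hca; simp [Expr.eval, hx]
    · have : (I.pos c : ℤ) ≠ I.pos a := fun hc => hca (I.pos_injective (by exact_mod_cast hc))
      simpa [Expr.eval, hx, this, hca] using h c
  · have : (I.pos a : ℤ) ≠ I.pos b := fun hc => hab (I.pos_injective (by exact_mod_cast hc))
    rw [run_ite_neg (by simpa [Test.Holds, Expr.eval, hx, hy] using this), run_skip]
    intro c
    rw [h c, List.mem_append, List.mem_singleton, Prod.mk.injEq]
    have : ¬ (c = a ∧ c = b) := fun ⟨h1, h2⟩ => hab (h1.symm.trans h2)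
    tauto

/-- Reads one forbidden pair. -/
def readPairProg : ForProg :=
  .seq (.assign 3 (.add (.get 2 (.get 0 (.var 16))) (.get 0 (.add (.var 16) (.const 1)))))
    (.seq (.assign 4 (.add (.get 2 (.get 0 (.add (.var 16) (.const 2))))
      (.get 0 (.add (.var 16) (.const 3)))))
    (.seq (.assign 16 (.add (.var 16) (.const 4)))
      (.seq (lowerProg 3 4) (.seq (lowerProg 4 3) excludeProg))))

/-- `a` and `b` are equal or form a pair in `T`. -/
def Linked (T : List (I.Item × I.Item)) (a b : I.Item) : Prop :=
  b = a ∨ (a, b) ∈ T ∨ (b, a) ∈ T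

/-- What is known after `t` pairs have been read. -/
def PairInv (I : RIS) (t : ℕ) (s : State) : Prop :=
  s.var 16 = I.off I.m + 1 + 4 * t ∧ RepOf (I := I) (Linked (I.T.take t)) (s.arr 5) ∧
    BadOf (I.T.take t) (s.arr 6)

theorem readPairProg_spec {s : State} {t : ℕ} (ht : t < I.T.length) (ha : s.arr 0 = I.inp)
    (h2 : ∀ i : Fin I.m, s.arr 2 (i : ℕ) = I.off i + 2) (h : PairInv I t s) :
    PairInv I (t + 1) (readPairProg.run s) := by
  obtain ⟨h16, h5, h6⟩ := h
  have q0 := I.inp_pair ht (k := 0) (by omega)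
  have q1 := I.inp_pair ht (k := 1) (by omega)
  have q2 := I.inp_pair ht (k := 2) (by omega)
  have q3 := I.inp_pair ht (k := 3) (by omega)
  push_cast at q0 q1 q2 q3
  simp only [encodeItem, List.cons_append, List.nil_append, List.getD_cons_zero,
    List.getD_cons_succ, add_zero] at q0 q1 q2 q3
  have hT : I.T.take (t + 1) = I.T.take t ++ [(I.T[t].1, I.T[t].2)] := by
    rw [List.take_succ_eq_append_getElem ht]
  unfold PairInv
  rw [hT]
  generalize I.T[t].1 = a at *
  generalize I.T[t].2 = b at *
  unfold readPairProg
  simp only [run_seq]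
  set s1 := (ForProg.assign 16 (.add (.var 16) (.const 4))).run
    ((ForProg.assign 4 (.add (.get 2 (.get 0 (.add (.var 16) (.const 2))))
      (.get 0 (.add (.var 16) (.const 3))))).run ((ForProg.assign 3
        (.add (.get 2 (.get 0 (.var 16))) (.get 0 (.add (.var 16) (.const 1))))).run s)) with hs1
  have e3 : s1.var 3 = I.pos a := by
    simp [hs1, Expr.eval, h16, ha, q0, q1, h2, pos]
  have e4 : s1.var 4 = I.pos b := by
    simp [hs1, Expr.eval, h16, ha, q2, q3, h2, pos]
  have e16 : s1.var 16 = I.off I.m + 1 + 4 * (t + 1) := by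
    simp [hs1, Expr.eval, h16]; ring
  have a5 : s1.arr 5 = s.arr 5 := by simp [hs1]
  have a6 : s1.arr 6 = s.arr 6 := by simp [hs1]
  clear_value s1
  have g1 := lowerProg_spec (L' := fun c d => Linked (I.T.take t) c d ∨ (c = a ∧ d = b)) e3 e4
    (by rw [a5]; exact h5) (fun _ _ => Iff.rfl)
  have hF1 := run_frame (lowerProg 3 4) s1
  generalize (lowerProg 3 4).run s1 = s2 at *
  have f3 := (hF1.1 3 (by decide)).trans e3
  have f4 := (hF1.1 4 (by decide)).trans e4
  have g2 := lowerProg_spec (L' := fun c d => (Linked (I.T.take t) c d ∨ (c = a ∧ d = b)) ∨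
    (c = b ∧ d = a)) f4 f3 g1 (fun _ _ => Iff.rfl)
  have hF2 := run_frame (lowerProg 4 3) s2
  generalize (lowerProg 4 3).run s2 = s3 at *
  have g3 := excludeProg_spec (T := I.T.take t) ((hF2.1 3 (by decide)).trans f3)
    ((hF2.1 4 (by decide)).trans f4)
    (by rw [hF2.2 6 (by decide), hF1.2 6 (by decide), a6]; exact h6)
  refine ⟨?_, ?_, g3⟩
  · rw [run_var (by decide), hF2.1 16 (by decide), hF1.1 16 (by decide), e16]; push_cast; ring
  · rw [run_arr (by decide)]
    convert g2 using 1
    funext c d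
    simp only [Linked, List.mem_append, List.mem_singleton, Prod.mk.injEq, eq_iff_iff]
    tauto

/-- Reads the forbidden pairs. -/
def readPairsProg : ForProg :=
  .seq (.assign 19 (.get 0 (.var 16))) (.seq (.assign 16 (.add (.var 16) (.const 1)))
    (.seq (.times 3 (.put 5 (.var 3) (.var 3))) (.upto 13 19 readPairProg)))

theorem readPairsProg_spec {s : State} (h0 : s.var 0 = I.len) (h16 : s.var 16 = I.off I.m)
    (ha : s.arr 0 = I.inp) (h2 : ∀ i : Fin I.m, s.arr 2 (i : ℕ) = I.off i + 2)
    (h6 : s.arr 6 = fun _ => 0) :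
    RepOf (I := I) (Linked I.T) ((readPairsProg.run s).arr 5) ∧
      BadOf I.T ((readPairsProg.run s).arr 6) := by
  unfold readPairsProg
  simp only [run_seq]
  set s1 := (ForProg.assign 16 (.add (.var 16) (.const 1))).run
    ((ForProg.assign 19 (.get 0 (.var 16))).run s) with hs1
  have e16 : s1.var 16 = I.off I.m + 1 := by simp [hs1, Expr.eval, h16]
  have e19 : s1.var 19 = I.T.length := by simp [hs1, Expr.eval, h16, ha, inp_off_m]
  have e0 : s1.var 0 = I.len := by simp [hs1, h0]
  have a0 : s1.arr = s.arr := by simp [hs1]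
  clear_value s1
  have hrep : ∀ k : ℕ, k < I.len →
      ((times 3 (.put 5 (.var 3) (.var 3))).run s1).arr 5 k = k :=
    run_times_map (by decide) e0 5 (fun z => z) (fun k s' hk hx hF _ => by
      simp [Expr.eval, hx])
  have hF1 := run_frame (times 3 (.put 5 (.var 3) (.var 3))) s1
  generalize (times 3 (.put 5 (.var 3) (.var 3))).run s1 = s2 at *
  have key := run_upto (x := 13) (y := 19) (P := readPairProg) (by decide) (by decide)
    ((hF1.1 0 (by decide)).trans e0) ((hF1.1 19 (by decide)).trans e19)
    (by rw [len_eq]; omega) (PairInv I) ?_ ?_ ?_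
  · unfold PairInv at key
    rw [List.take_length] at key
    exact key.2
  · refine ⟨?_, ?_, ?_⟩
    · simp [hF1.1 16 (by decide), e16]
    · intro a
      simp only [State.setVar_arr, hrep _ (I.pos_lt a)]
      simp [Linked]
    · intro a
      simp [hF1.2 6 (by decide), a0, h6]
  · intro s' z h; simpa [PairInv] using h
  · intro k s' hk hx hF hI
    have := readPairProg_spec hk
      ((hF.2 0 (by decide)).trans ((hF1.2 0 (by decide)).trans (by rw [a0, ha])))
      (by rw [hF.2 2 (by decide), hF1.2 2 (by decide), a0]; exact h2) hI
    simpa [PairInv] using this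

/-! ### The cost of an impossible choice -/

/-- Computes in variable `2` a number larger than all total costs. -/
def boundProg : ForProg :=
  .seq (.assign 2 (.const 1)) (.times 3 (.times 4 (.ite (.le (.const 0) (.get 0 (.var 4)))
    (.assign 2 (.add (.var 2) (.get 0 (.var 4))))
    (.assign 2 (.sub (.var 2) (.get 0 (.var 4)))))))

/-- The sum of the absolute values of all input numbers. -/
def total (I : RIS) : ℤ := ∑ q ∈ Finset.range I.len, |I.inp q|

theorem boundProg_spec {s : State} (h0 : s.var 0 = I.len) (ha : s.arr 0 = I.inp) :
    (boundProg.run s).var 2 = 1 + I.len * I.total := by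
  unfold boundProg
  rw [run_seq]
  refine run_times (by decide) (n := I.len) (by simpa using h0)
    (fun k s' => s'.var 2 = 1 + k * I.total) (by simp [Expr.eval]) ?_
  intro k s' hk hx hF hI
  have := run_times (x := 4) (P := .ite (.le (.const 0) (.get 0 (.var 4)))
    (.assign 2 (.add (.var 2) (.get 0 (.var 4))))
    (.assign 2 (.sub (.var 2) (.get 0 (.var 4))))) (by decide) (n := I.len) (s := s')
    ((hF.1 0 (by decide)).trans (by simpa using h0))
    (fun l s'' => s''.var 2 = 1 + k * I.total + ∑ q ∈ Finset.range l, |I.inp q|) ?_ ?_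
  · simp only [State.setVar_var, this, total]
    push_cast; ring
  · simpa using hI
  · intro l s'' hl hx' hF' hI'
    have a0 : s''.arr 0 = I.inp := by
      rw [hF'.2 0 (by decide), hF.2 0 (by decide)]; simpa using ha
    rw [Finset.sum_range_succ]
    by_cases hc : 0 ≤ I.inp l
    · rw [run_ite_pos (by simpa [Test.Holds, Expr.eval, a0, hx'] using hc), abs_of_nonneg hc]
      simp [Expr.eval, a0, hx', hI']; ring
    · rw [run_ite_neg (by simpa [Test.Holds, Expr.eval, a0, hx'] using hc),
        abs_of_neg (not_le.1 hc)]
      simp [Expr.eval, a0, hx', hI']; ring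

end RIS

theorem Finset.exists_extend_injOn {n : ℕ} {A : Finset ℕ} {f : ℕ → ℕ} (hA : ∀ r ∈ A, r < n)
    (hf : ∀ r ∈ A, f r < n) (hinj : ∀ r ∈ A, ∀ r' ∈ A, f r = f r' → r = r') :
    ∃ τ : ℕ → ℕ, (∀ r < n, τ r < n) ∧ (∀ r < n, ∀ r' < n, τ r = τ r' → r = r') ∧
      ∀ r ∈ A, τ r = f r := by
  obtain ⟨g, hg⟩ := Finset.exists_equiv_extend_of_card_eq (α := Fin n) (t := Finset.range n)
    (by simp) (s := Finset.univ.filter fun r : Fin n => (r : ℕ) ∈ A) (f := fun r => f r)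
    (by
      intro j hj
      obtain ⟨r, hr, rfl⟩ := Finset.mem_image.1 hj
      exact Finset.mem_range.2 (hf r (Finset.mem_filter.1 hr).2))
    (by
      intro r hr r' hr' h
      simp only [Finset.coe_filter, Finset.mem_univ, true_and, Set.mem_ofPred_eq] at hr hr'
      exact Fin.ext (hinj r hr r' hr' h))
  refine ⟨fun r => if h : r < n then g ⟨r, h⟩ else 0, ?_, ?_, ?_⟩
  · intro r hr
    simp only [hr, dif_pos]
    exact Finset.mem_range.1 (g ⟨r, hr⟩).2
  · intro r hr r' hr' h
    simp only [hr, hr', dif_pos] at h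
    simpa using g.injective (Subtype.ext h)
  · intro r hr
    simp only [hA r hr, dif_pos]
    exact hg ⟨r, hA r hr⟩ (by simpa using hr)

namespace RIS

open RAM

variable {I : RIS}

/-! ### Sets of items and selections -/

/-- The selection that consists of the items in `A`. -/
def toSelection (A : Finset I.Item) : I.Selection := fun i =>
  Finset.univ.filter fun k => (⟨i, k⟩ : I.Item) ∈ A

/-- The set of the selected items. -/
def items (S : I.Selection) : Finset I.Item := Finset.univ.sigma S

@[simp] theorem mem_items {S : I.Selection} {a : I.Item} : a ∈ items S ↔ a.2 ∈ S a.1 := by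
  simp [items]

@[simp] theorem mem_toSelection {A : Finset I.Item} {i : Fin I.m} {k : Fin (I.r i)} :
    k ∈ toSelection A i ↔ (⟨i, k⟩ : I.Item) ∈ A := by
  simp [toSelection]

theorem items_toSelection (A : Finset I.Item) : items (toSelection A) = A := by
  ext a; simp

theorem cost_eq (S : I.Selection) : I.cost S = ∑ a ∈ items S, I.c a.1 a.2 := by
  rw [items, Finset.sum_sigma]; rfl

theorem card_toSelection (A : Finset I.Item) (i : Fin I.m) :
    (toSelection A i).card = (A.filter fun a => a.1 = i).card := by
  rw [← Finset.card_map (s := toSelection A i)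
    (Function.Embedding.sigmaMk (β := fun i => Fin (I.r i)) i)]
  congr 1
  ext ⟨j, k⟩
  simp only [Finset.mem_map, mem_toSelection, Function.Embedding.sigmaMk_apply, Finset.mem_filter]
  constructor
  · rintro ⟨k', h, h'⟩
    cases h'; exact ⟨h, rfl⟩
  · rintro ⟨h, rfl⟩
    exact ⟨k, h, rfl⟩

/-- The slots as a finite set. -/
def slotFinset (I : RIS) : Finset I.Item := Finset.univ.filter fun a => (a.2 : ℕ) < I.p a.1

@[simp] theorem mem_slotFinset {a : I.Item} : a ∈ I.slotFinset ↔ (a.2 : ℕ) < I.p a.1 := by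
  simp [slotFinset]

theorem card_slots (i : Fin I.m) : (I.slotFinset.filter fun a => a.1 = i).card = I.p i := by
  rw [← card_toSelection]
  have : (toSelection I.slotFinset i).map Fin.valEmbedding = Finset.range (I.p i) := by
    ext k
    simp only [Finset.mem_map, mem_toSelection, mem_slotFinset, Fin.valEmbedding_apply,
      Finset.mem_range]
    constructor
    · rintro ⟨k', h, rfl⟩; exact h
    · exact fun h => ⟨⟨k, h.trans (I.p_lt i)⟩, h, rfl⟩
  rw [← Finset.card_map, this, Finset.card_range]

theorem card_slotFinset : I.slotFinset.card = ∑ i, I.p i := by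
  rw [Finset.card_eq_sum_card_fiberwise (f := fun a => a.1) (t := Finset.univ) (by simp)]
  exact Finset.sum_congr rfl fun i _ => card_slots i

/-- A selection of the right size is enumerated by the slots. -/
theorem exists_enumeration {S : I.Selection} (hS : ∀ i, (S i).card = I.p i) :
    ∃ e : I.Item → I.Item, (∀ a ∈ I.slotFinset, (e a).1 = a.1) ∧
      (∀ a ∈ I.slotFinset, ∀ b ∈ I.slotFinset, e a = e b → a = b) ∧
      I.slotFinset.image e = items S := by
  let e : I.Item → I.Item := fun a => if h : (a.2 : ℕ) < I.p a.1 then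
    ⟨a.1, (S a.1).orderEmbOfFin (hS a.1) ⟨a.2, h⟩⟩ else a
  have he1 : ∀ a, (e a).1 = a.1 := by
    intro a; simp only [e]; split_ifs <;> rfl
  have hinj : ∀ a ∈ I.slotFinset, ∀ b ∈ I.slotFinset, e a = e b → a = b := by
    rintro ⟨i, k⟩ ha ⟨i', k'⟩ hb h
    obtain rfl : i = i' := by
      have := congrArg Sigma.fst h
      rwa [he1, he1] at this
    simp only [mem_slotFinset] at ha hb
    simp only [e, ha, hb, dif_pos] at h
    have h2 := eq_of_heq (Sigma.mk.inj h).2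
    have h3 := ((S i).orderEmbOfFin (hS i)).injective h2
    simp only [Fin.mk.injEq] at h3
    exact Item.ext_val rfl h3
  refine ⟨e, fun a _ => he1 a, hinj, ?_⟩
  refine Finset.eq_of_subset_of_card_le ?_ ?_
  · intro b hb
    obtain ⟨a, ha, rfl⟩ := Finset.mem_image.1 hb
    rw [mem_slotFinset] at ha
    simp only [e, ha, dif_pos, mem_items]
    exact Finset.orderEmbOfFin_mem _ _ _
  · rw [Finset.card_image_of_injOn (fun a ha b hb => hinj a ha b hb), card_slotFinset, items,
      Finset.card_sigma]
    exact (Finset.sum_congr rfl fun i _ => hS i).le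

/-! ### The assignment problem of an instance -/

/-- `D` contains the data of the assignment problem of the instance. -/
structure TableOf (I : RIS) (D : Table) : Prop where
  bound : D.bound = 1 + I.len * I.total
  cost : D.cost = I.inp
  set : Marked (Set.univ : Set I.Item) D.set
  row : Marked I.slots D.row
  rep : RepOf (I := I) (Linked I.T) D.rep
  bad : BadOf I.T D.bad

variable {D : Table}

theorem abs_inp_le {q : ℕ} (hq : q < I.len) : |I.inp q| ≤ I.total :=
  Finset.single_le_sum (f := fun q : ℕ => |I.inp q|) (fun _ _ => abs_nonneg _)
    (Finset.mem_range.2 hq)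

theorem total_nonneg : 0 ≤ I.total := Finset.sum_nonneg fun _ _ => abs_nonneg _

theorem cost_le_total (S : I.Selection) : I.cost S ≤ I.total := by
  rw [cost_eq]
  calc ∑ a ∈ items S, I.c a.1 a.2 ≤ ∑ a ∈ items S, |I.inp (I.pos a)| :=
        Finset.sum_le_sum fun a _ => by rw [inp_pos]; exact le_abs_self _
    _ = ∑ q ∈ (items S).image I.pos, |I.inp q| := by
        rw [Finset.sum_image fun a _ b _ h => I.pos_injective h]
    _ ≤ I.total := by
        refine Finset.sum_le_sum_of_subset_of_nonneg ?_ fun _ _ _ => abs_nonneg _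
        intro q hq
        obtain ⟨a, -, rfl⟩ := Finset.mem_image.1 hq
        exact Finset.mem_range.2 (I.pos_lt a)

namespace TableOf

theorem neg_total_le_weight (h : TableOf I D) (r j : ℤ) : -I.total ≤ D.weight I.len r j := by
  have h0 := I.total_nonneg
  unfold Table.weight
  split_ifs
  · omega
  · rcases (D.scan_spec r j I.len).1 with h1 | ⟨q, hq, -, h1, -⟩
    · rw [h1, h.bound]
      have : 0 ≤ (I.len : ℤ) * I.total := by positivity
      omega
    · rw [h1, h.cost]
      exact (abs_le.1 (abs_inp_le hq)).1

theorem total_lt_bound (h : TableOf I D) : I.total < D.bound := by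
  rw [h.bound]
  have h0 := I.total_nonneg
  have h1 : (1 : ℤ) ≤ I.len := by rw [len_eq]; omega
  nlinarith

theorem row_ne (h : TableOf I D) {a : I.Item} (ha : a ∈ I.slotFinset) : D.row (I.pos a) ≠ 0 := by
  rw [h.row.1 a (by simpa [slots] using ha)]; omega

theorem weight_slot (h : TableOf I D) {a : I.Item} (ha : a ∈ I.slotFinset) (j : ℤ) :
    D.weight I.len (I.pos a) j = (D.scan (I.pos a) j I.len).1 := by
  rw [Table.weight, if_neg (h.row_ne ha)]

theorem fits_iff (h : TableOf I D) {a : I.Item} (ha : a ∈ I.slotFinset) (j : ℤ) (q : ℤ) :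
    D.Fits (I.pos a) j q ↔
      ∃ b : I.Item, q = I.pos b ∧ b.1 = a.1 ∧ (b, b) ∉ I.T ∧ D.rep (I.pos b) = j := by
  unfold Table.Fits
  rw [h.row.1 a (by simpa [slots] using ha)]
  constructor
  · rintro ⟨h1, h2, h3⟩
    obtain ⟨b, -, rfl⟩ := h.set.2 q (by rw [h1]; omega)
    rw [h.set.1 b (Set.mem_univ _)] at h1
    exact ⟨b, rfl, Fin.ext (by omega), (h.bad b).1 h2, h3⟩
  · rintro ⟨b, rfl, h1, h2, h3⟩
    exact ⟨by rw [h.set.1 b (Set.mem_univ _), h1], (h.bad b).2 h2, h3⟩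

theorem weight_le (h : TableOf I D) {a b : I.Item} (ha : a ∈ I.slotFinset) (hab : b.1 = a.1)
    (hb : (b, b) ∉ I.T) : D.weight I.len (I.pos a) (D.rep (I.pos b)) ≤ I.c b.1 b.2 := by
  rw [h.weight_slot ha, ← inp_pos, ← h.cost]
  exact (D.scan_spec _ _ _).2 _ (I.pos_lt b) ((h.fits_iff ha _ _).2 ⟨b, rfl, hab, hb, rfl⟩)

theorem exists_item (h : TableOf I D) {a : I.Item} (ha : a ∈ I.slotFinset) {j : ℤ}
    (hne : D.weight I.len (I.pos a) j ≠ D.bound) :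
    ∃ b : I.Item, (D.scan (I.pos a) j I.len).2 = I.pos b ∧ b.1 = a.1 ∧ (b, b) ∉ I.T ∧
      D.rep (I.pos b) = j ∧ D.weight I.len (I.pos a) j = I.c b.1 b.2 := by
  rw [h.weight_slot ha] at hne ⊢
  obtain ⟨q, hq, h1, h2, h3⟩ := (D.scan_spec _ _ _).1.resolve_left hne
  obtain ⟨b, g1, g2, g3, g4⟩ := (h.fits_iff ha _ _).1 h1
  refine ⟨b, h3.trans g1, g2, g3, g4, ?_⟩
  rw [h2, h.cost, g1, inp_pos]

theorem sum_weight (h : TableOf I D) (τ : ℕ → ℕ) :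
    ∑ r ∈ Finset.range I.len, D.weight I.len r (τ r) =
      ∑ a ∈ I.slotFinset, D.weight I.len (I.pos a) (τ (I.pos a)) := by
  rw [← Finset.sum_image (f := fun r : ℕ => D.weight I.len r (τ r)) (g := I.pos)
    fun a _ b _ h => I.pos_injective h]
  symm
  refine Finset.sum_subset ?_ ?_
  · intro q hq
    obtain ⟨a, -, rfl⟩ := Finset.mem_image.1 hq
    exact Finset.mem_range.2 (I.pos_lt a)
  · intro r _ hr
    rw [Table.weight, if_pos]
    by_contra hne
    obtain ⟨a, ha, hra⟩ := h.row.2 _ hne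
    exact hr (Finset.mem_image.2 ⟨a, by simpa [slots] using ha, by exact_mod_cast hra.symm⟩)

/-- Two items lie in the same column if and only if they are equal or form a forbidden pair. -/
theorem rep_eq_iff (h : TableOf I D) (hI : I.TransitiveForbiddance) (a b : I.Item) :
    D.rep (I.pos a) = D.rep (I.pos b) ↔ Linked I.T a b := by
  have hsymm : ∀ a b, Linked I.T a b → Linked I.T b a := by
    unfold Linked; intro a b h; rcases h with h | h | h <;> simp [h]
  have htrans : ∀ a b d, Linked I.T a b → Linked I.T b d → Linked I.T a d := by
    intro a b d h1 h2
    by_cases hab : b = a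
    · rwa [← hab]
    by_cases hbd : d = b
    · rwa [hbd]
    by_cases had : d = a
    · exact Or.inl had
    · exact Or.inr (hI a b d (Ne.symm had) (h1.resolve_left hab) (h2.resolve_left hbd))
  obtain ⟨⟨x, hx1, hx2⟩, hx3⟩ := h.rep a
  obtain ⟨⟨y, hy1, hy2⟩, hy3⟩ := h.rep b
  constructor
  · intro he
    obtain rfl : x = y := I.pos_injective (by rw [hx2, hy2] at he; exact_mod_cast he)
    exact htrans _ _ _ hx1 (hsymm _ _ hy1)
  · intro hab
    refine le_antisymm ?_ ?_
    · rw [hy2]; exact hx3 y (htrans _ _ _ hab hy1)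
    · rw [hx2]; exact hy3 x (htrans _ _ _ (hsymm _ _ hab) hx1)

/-- Every feasible selection yields an assignment that costs at most as much. -/
theorem exists_assignment (h : TableOf I D) (hI : I.TransitiveForbiddance) {S : I.Selection}
    (hS : I.Feasible S) :
    ∃ τ : ℕ → ℕ, (∀ r < I.len, τ r < I.len) ∧
      (∀ r < I.len, ∀ r' < I.len, τ r = τ r' → r = r') ∧
      ∑ r ∈ Finset.range I.len, D.weight I.len r (τ r) ≤ I.cost S := by
  obtain ⟨e, he1, he2, he3⟩ := exists_enumeration hS.1
  have hmem : ∀ a ∈ I.slotFinset, (e a).2 ∈ S (e a).1 := fun a ha => by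
    rw [← mem_items, ← he3]; exact Finset.mem_image_of_mem e ha
  have hsel : ∀ a ∈ I.slotFinset, ∀ b ∈ I.slotFinset, (e a, e b) ∉ I.T := fun a ha b hb hT =>
    hS.2 _ _ hT ⟨hmem a ha, hmem b hb⟩
  choose x hx using fun a => (h.rep a).1
  have hf : ∀ a, Function.extend I.pos (fun a => I.pos (x (e a))) 0 (I.pos a) = I.pos (x (e a)) :=
    fun a => I.pos_injective.extend_apply _ _ a
  obtain ⟨τ, h1, h2, h3⟩ := Finset.exists_extend_injOn (n := I.len)
    (A := I.slotFinset.image I.pos) (f := Function.extend I.pos (fun a => I.pos (x (e a))) 0)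
    (by
      intro r hr
      obtain ⟨a, -, rfl⟩ := Finset.mem_image.1 hr
      exact I.pos_lt a)
    (by
      intro r hr
      obtain ⟨a, -, rfl⟩ := Finset.mem_image.1 hr
      rw [hf]; exact I.pos_lt _)
    (by
      intro r hr r' hr' heq
      obtain ⟨a, ha, rfl⟩ := Finset.mem_image.1 hr
      obtain ⟨b, hb, rfl⟩ := Finset.mem_image.1 hr'
      rw [hf, hf] at heq
      have : D.rep (I.pos (e a)) = D.rep (I.pos (e b)) := by
        rw [(hx _).2, (hx _).2, heq]
      rcases (h.rep_eq_iff hI _ _).1 this with h4 | h4 | h4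
      · rw [he2 a ha b hb h4.symm]
      · exact absurd h4 (hsel a ha b hb)
      · exact absurd h4 (hsel b hb a ha))
  refine ⟨τ, h1, h2, ?_⟩
  rw [h.sum_weight, cost_eq, ← he3, Finset.sum_image fun a ha b hb => he2 a ha b hb]
  refine Finset.sum_le_sum fun a ha => ?_
  rw [h3 _ (Finset.mem_image_of_mem _ ha), hf, ← (hx _).2]
  exact h.weight_le ha (he1 a ha) (hsel a ha a ha)

variable {μ : ℕ → ℕ}

/-- If an optimal assignment makes an impossible choice, then no selection is feasible. -/
theorem not_feasible (h : TableOf I D) (hI : I.TransitiveForbiddance)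
    (hopt : ∀ τ : ℕ → ℕ, (∀ r < I.len, τ r < I.len) →
      (∀ r < I.len, ∀ r' < I.len, τ r = τ r' → r = r') →
        ∑ r ∈ Finset.range I.len, D.weight I.len r (μ r) ≤
          ∑ r ∈ Finset.range I.len, D.weight I.len r (τ r))
    {r : ℕ} (hr : r < I.len) (hb : D.weight I.len r (μ r) = D.bound) (S : I.Selection) :
    ¬ I.Feasible S := by
  intro hS
  obtain ⟨τ, h1, h2, h3⟩ := h.exists_assignment hI hS
  have h4 := (hopt τ h1 h2).trans (h3.trans (cost_le_total S))
  have h5 := Finset.single_le_sum (f := fun r : ℕ => D.weight I.len r (μ r) + I.total)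
    (fun r _ => by have := h.neg_total_le_weight r (μ r); omega)
    (Finset.mem_range.2 hr)
  simp only [Finset.sum_add_distrib, Finset.sum_const, Finset.card_range, nsmul_eq_mul, hb,
    h.bound] at h5
  linarith

/-- An optimal assignment without impossible choices yields an optimal selection. -/
theorem exists_optimal (h : TableOf I D) (hI : I.TransitiveForbiddance)
    (hinj : ∀ r < I.len, ∀ r' < I.len, μ r = μ r' → r = r')
    (hopt : ∀ τ : ℕ → ℕ, (∀ r < I.len, τ r < I.len) →
      (∀ r < I.len, ∀ r' < I.len, τ r = τ r' → r = r') →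
        ∑ r ∈ Finset.range I.len, D.weight I.len r (μ r) ≤
          ∑ r ∈ Finset.range I.len, D.weight I.len r (τ r))
    (hb : ∀ r : ℕ, r < I.len → D.row r ≠ 0 → D.weight I.len r (μ r) ≠ D.bound) :
    ∃ S, I.Optimal S ∧ ∀ b : I.Item, b.2 ∈ S b.1 ↔
      ∃ r : ℕ, r < I.len ∧ D.row r ≠ 0 ∧ (D.scan r (μ r) I.len).2 = I.pos b := by
  have hex : ∀ a : I.Item, ∃ b : I.Item, a ∈ I.slotFinset →
      ((D.scan (I.pos a) (μ (I.pos a)) I.len).2 = I.pos b ∧ b.1 = a.1 ∧ (b, b) ∉ I.T ∧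
      D.rep (I.pos b) = μ (I.pos a) ∧ D.weight I.len (I.pos a) (μ (I.pos a)) = I.c b.1 b.2) := by
    intro a
    by_cases ha : a ∈ I.slotFinset
    · obtain ⟨b, hb⟩ := h.exists_item ha (hb _ (I.pos_lt a) (h.row_ne ha))
      exact ⟨b, fun _ => hb⟩
    · exact ⟨a, fun hc => absurd hc ha⟩
  choose e he using hex
  have hcol : ∀ a ∈ I.slotFinset, ∀ b ∈ I.slotFinset, Linked I.T (e a) (e b) → a = b := by
    intro a ha b hb hl
    have h1 := (h.rep_eq_iff hI _ _).2 hl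
    rw [(he a ha).2.2.2.1, (he b hb).2.2.2.1] at h1
    exact I.pos_injective (hinj _ (I.pos_lt a) _ (I.pos_lt b) (by exact_mod_cast h1))
  have heinj : ∀ a ∈ I.slotFinset, ∀ b ∈ I.slotFinset, e a = e b → a = b :=
    fun a ha b hb hab => hcol a ha b hb (Or.inl hab.symm)
  refine ⟨toSelection (I.slotFinset.image e), ⟨⟨?_, ?_⟩, ?_⟩, ?_⟩
  · intro i
    rw [card_toSelection, ← card_slots i]
    have : (I.slotFinset.image e).filter (fun a => a.1 = i) =
        (I.slotFinset.filter fun a => a.1 = i).image e := by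
      ext b
      simp only [Finset.mem_filter, Finset.mem_image]
      constructor
      · rintro ⟨⟨a, ha, rfl⟩, hbi⟩
        exact ⟨a, ⟨ha, (he a ha).2.1 ▸ hbi⟩, rfl⟩
      · rintro ⟨a, ⟨ha, hai⟩, rfl⟩
        exact ⟨⟨a, ha, rfl⟩, (he a ha).2.1.trans hai⟩
    rw [this, Finset.card_image_of_injOn]
    intro a ha b hb
    simp only [Finset.coe_filter, Set.mem_ofPred_eq] at ha hb
    exact heinj a ha.1 b hb.1
  · rintro a b hT ⟨ha, hb⟩
    have ha1 : a ∈ I.slotFinset.image e := mem_toSelection.1 ha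
    have hb1 : b ∈ I.slotFinset.image e := mem_toSelection.1 hb
    obtain ⟨a', ha', rfl⟩ := Finset.mem_image.1 ha1
    obtain ⟨b', hb', rfl⟩ := Finset.mem_image.1 hb1
    obtain rfl := hcol a' ha' b' hb' (Or.inr (Or.inl hT))
    exact (he a' ha').2.2.1 hT
  · intro S' hS'
    obtain ⟨τ, h1, h2, h3⟩ := h.exists_assignment hI hS'
    refine le_trans ?_ ((hopt τ h1 h2).trans h3)
    rw [h.sum_weight, cost_eq, items_toSelection,
      Finset.sum_image fun a ha b hb => heinj a ha b hb]
    exact Finset.sum_le_sum fun a ha => (he a ha).2.2.2.2.ge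
  · intro b
    have hiff : b.2 ∈ toSelection (I.slotFinset.image e) b.1 ↔ b ∈ I.slotFinset.image e :=
      mem_toSelection
    rw [hiff, Finset.mem_image]
    constructor
    · rintro ⟨a, ha, rfl⟩
      exact ⟨I.pos a, I.pos_lt a, h.row_ne ha, (he a ha).1⟩
    · rintro ⟨r, hr, hrow, hs⟩
      obtain ⟨a, ha, hra⟩ := h.row.2 _ hrow
      obtain rfl : r = I.pos a := by exact_mod_cast hra
      have ha' : a ∈ I.slotFinset := by simpa [slots] using ha
      refine ⟨a, ha', I.pos_injective ?_⟩
      have := (he a ha').1.symm.trans hs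
      exact_mod_cast this

end TableOf

end RIS

namespace RIS

open RAM ForProg

variable {I : RIS}

/-! ### The output -/

open Classical in
/-- What is known after the choices of `k` rows have been recorded: variable `15` tells whether all
of them are possible, and the array `12` contains the chosen items. -/
def SelectInv (D : Table) (n : ℕ) (μ : ℕ → ℕ) (k : ℕ) (s : State) : Prop :=
  (s.var 15 = 1 ∧ (∀ r : ℕ, r < k → D.row r ≠ 0 → D.weight n r (μ r) ≠ D.bound) ∧
      ∀ q : ℤ, s.arr 12 q =
        if ∃ r : ℕ, r < k ∧ D.row r ≠ 0 ∧ (D.scan r (μ r) n).2 = q then 1 else 0) ∨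
    (s.var 15 = 0 ∧ ∃ r : ℕ, r < k ∧ D.row r ≠ 0 ∧ D.weight n r (μ r) = D.bound)

/-- Records the choice of a row. -/
def selectStepProg : ForProg :=
  .ite (.eq (.get 4 (.var 3)) (.const 0)) .skip
    (.seq (.assign 4 (.get 9 (.var 3))) (.seq entryProg
      (.ite (.eq (.var 5) (.var 2)) (.assign 15 (.const 0)) (.put 12 (.var 6) (.const 1)))))

theorem selectStepProg_spec {s : State} {n k : ℕ} {μ : ℕ → ℕ} (hn : s.var 0 = n)
    (h3 : s.var 3 = k) (h9 : s.arr 9 k = μ k) (h : SelectInv s.table n μ k s) :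
    SelectInv s.table n μ (k + 1) (selectStepProg.run s) := by
  unfold selectStepProg
  by_cases hrow : s.table.row k = 0
  · rw [run_ite_pos (by simpa [Test.Holds, Expr.eval, h3, State.table] using hrow), run_skip]
    rcases h with ⟨h1, h2, h4⟩ | ⟨h1, r, h2, h4⟩
    · refine Or.inl ⟨h1, fun r hr hrr => ?_, fun q => ?_⟩
      · rcases Nat.lt_succ_iff_lt_or_eq.1 hr with hlt | rfl
        · exact h2 r hlt hrr
        · exact absurd hrow hrr
      · rw [h4]
        refine if_congr ?_ rfl rfl
        constructor
        · rintro ⟨r, g1, g2⟩; exact ⟨r, by omega, g2⟩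
        · rintro ⟨r, g1, g2⟩
          rcases Nat.lt_succ_iff_lt_or_eq.1 g1 with hlt | rfl
          · exact ⟨r, hlt, g2⟩
          · exact absurd hrow g2.1
    · exact Or.inr ⟨h1, r, by omega, h4⟩
  · rw [run_ite_neg (by simpa [Test.Holds, Expr.eval, h3, State.table] using hrow)]
    simp only [run_seq]
    set s1 := (ForProg.assign 4 (.get 9 (.var 3))).run s with hs1
    have t1 : s1.table = s.table := by simp [hs1, State.table]
    obtain ⟨e5, e6⟩ := entryProg_spec (s := s1) (n := n) (by simpa [hs1] using hn)
    have e3 : s1.var 3 = k := by simp [hs1, h3]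
    have e4 : s1.var 4 = μ k := by simp [hs1, Expr.eval, h3, h9]
    have e2 : s1.var 2 = s.table.bound := by simp [hs1, State.table]
    have e15 : s1.var 15 = s.var 15 := by simp [hs1]
    have a12 : s1.arr 12 = s.arr 12 := by simp [hs1]
    rw [e3, e4, t1] at e5 e6
    replace e6 := e6 (by simpa [hs1, State.table] using hrow)
    have hF := run_frame entryProg s1
    generalize entryProg.run s1 = s2 at *
    have f2 := (hF.1 2 (by decide)).trans e2
    have f15 := (hF.1 15 (by decide)).trans e15
    have b12 := (hF.2 12 (by decide)).trans a12
    by_cases hw : s.table.weight n k (μ k) = s.table.bound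
    · rw [run_ite_pos (by simpa [Test.Holds, Expr.eval, e5, f2] using hw)]
      exact Or.inr ⟨by simp [Expr.eval], k, by omega, hrow, hw⟩
    · rw [run_ite_neg (by simpa [Test.Holds, Expr.eval, e5, f2] using hw)]
      rcases h with ⟨h1, h2, h4⟩ | ⟨h1, r, h2, h4⟩
      · refine Or.inl ⟨by simp [f15, h1], fun r hr hrr => ?_, fun q => ?_⟩
        · rcases Nat.lt_succ_iff_lt_or_eq.1 hr with hlt | rfl
          · exact h2 r hlt hrr
          · exact hw
        · simp only [run_put, Expr.eval, e6, State.setArr_arr, if_true, b12]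
          by_cases hq : q = (s.table.scan k (μ k) n).2
          · rw [hq, Function.update_self, if_pos ⟨k, by omega, hrow, rfl⟩]
          · rw [Function.update_of_ne hq, h4]
            refine if_congr ?_ rfl rfl
            constructor
            · rintro ⟨r, g1, g2⟩; exact ⟨r, by omega, g2⟩
            · rintro ⟨r, g1, g2⟩
              rcases Nat.lt_succ_iff_lt_or_eq.1 g1 with hlt | rfl
              · exact ⟨r, hlt, g2⟩
              · exact absurd g2.2.symm hq
      · exact Or.inr ⟨by simp [f15, h1], r, by omega, h4⟩

/-- Records the choices of all rows. -/
def selectProg : ForProg :=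
  .seq (.assign 15 (.const 1)) (.times 3 selectStepProg)

theorem selectProg_spec {s : State} {n : ℕ} {μ : ℕ → ℕ} (hn : s.var 0 = n)
    (h9 : ∀ r : ℕ, r < n → s.arr 9 r = μ r) (h12 : s.arr 12 = fun _ => 0) :
    SelectInv s.table n μ n (selectProg.run s) := by
  unfold selectProg
  rw [run_seq]
  refine run_times (by decide) (n := n) (by simpa using hn) (SelectInv s.table n μ) ?_ ?_
  · exact Or.inl ⟨by simp [Expr.eval], by simp, by simp [h12]⟩
  · intro k s' hk hx hF hI
    have ht : s'.table = s.table := by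
      rw [State.table_eq_of_frame hF (by decide) (by decide) (by decide) (by decide) (by decide)
        (by decide)]
      simp [State.table]
    rw [← ht] at hI ⊢
    have := selectStepProg_spec ((hF.1 0 (by decide)).trans (by simpa using hn)) hx
      (by rw [hF.2 9 (by decide)]; simpa using h9 k hk) hI
    simpa [SelectInv] using this

/-- The array `1` starts with the list `l`, and variable `16` is its length. -/
def Written (l : List ℤ) (s : State) : Prop :=
  s.var 16 = l.length ∧ ∀ j < l.length, s.arr 1 j = l.getD j 0

/-- Appends the value of an expression to the output. -/
def writeProg (e : Expr) : ForProg :=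
  .seq (.put 1 (.var 16) e) (.assign 16 (.add (.var 16) (.const 1)))

theorem writeProg_spec {l : List ℤ} {s : State} (h : Written l s) (e : Expr) :
    Written (l ++ [e.eval s]) ((writeProg e).run s) := by
  obtain ⟨h1, h2⟩ := h
  refine ⟨by simp [writeProg, Expr.eval, h1], fun j hj => ?_⟩
  rw [List.length_append, List.length_singleton] at hj
  rcases Nat.lt_succ_iff_lt_or_eq.1 hj with hlt | rfl
  · have : (j : ℤ) ≠ l.length := by omega
    rw [List.getD_append _ _ _ _ hlt]
    simpa [writeProg, Expr.eval, h1, this] using h2 j hlt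
  · rw [List.getD_append_right _ _ _ _ le_rfl]
    simp [writeProg, Expr.eval, h1]

/-- Writes the characteristic vector of the selection from one set. -/
def writeSetProg : ForProg :=
  .seq (.assign 17 (.get 2 (.var 13))) (.seq (.assign 18 (.get 0 (.sub (.var 17) (.const 2))))
    (.upto 14 18 (writeProg (.get 12 (.add (.var 17) (.var 14))))))

theorem writeSetProg_spec {s : State} {l : List ℤ} {S : I.Selection} (i : Fin I.m)
    (h0 : s.var 0 = I.len) (h13 : s.var 13 = (i : ℕ)) (ha : s.arr 0 = I.inp)
    (h2 : s.arr 2 (i : ℕ) = I.off i + 2)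
    (h12 : ∀ a : I.Item, s.arr 12 (I.pos a) = if a.2 ∈ S a.1 then 1 else 0) (h : Written l s) :
    Written (l ++ List.ofFn fun k => if k ∈ S i then (1 : ℤ) else 0) (writeSetProg.run s) := by
  unfold writeSetProg
  simp only [run_seq]
  set s1 := (ForProg.assign 18 (.get 0 (.sub (.var 17) (.const 2)))).run
    ((ForProg.assign 17 (.get 2 (.var 13))).run s) with hs1
  have e17 : s1.var 17 = I.off i + 2 := by simp [hs1, Expr.eval, h13, h2]
  have e18 : s1.var 18 = I.r i := by simp [hs1, Expr.eval, h13, h2, ha, inp_r]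
  have e0 : s1.var 0 = I.len := by simp [hs1, h0]
  have a12 : s1.arr 12 = s.arr 12 := by simp [hs1]
  have hw : Written l s1 := by simpa [hs1, Written] using h
  clear_value s1
  have key := run_upto (x := 14) (y := 18)
    (P := writeProg (.get 12 (.add (.var 17) (.var 14)))) (by decide) (by decide) e0 e18
    (I.r_le_len i) (fun k s' => Written
      (l ++ (List.ofFn fun k => if k ∈ S i then (1 : ℤ) else 0).take k) s')
    (by simpa [Written] using hw) (fun s' z h => by simpa [Written] using h) ?_
  · rwa [List.take_of_length_le (by simp)] at key
  · intro k s' hk hx hF hI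
    have := writeProg_spec hI (.get 12 (.add (.var 17) (.var 14)))
    have hv : (Expr.get 12 (.add (.var 17) (.var 14))).eval s' =
        if (⟨k, hk⟩ : Fin (I.r i)) ∈ S i then (1 : ℤ) else 0 := by
      have h := h12 ⟨i, ⟨k, hk⟩⟩
      simp only [pos] at h
      push_cast at h
      simp only [Expr.eval, hx, hF.1 17 (by decide), hF.2 12 (by decide), e17, a12, h]
    rw [hv, List.append_assoc] at this
    rw [List.take_succ_eq_append_getElem (by simpa using hk), List.getElem_ofFn]
    simpa [Written] using this

/-- Writes the answer. -/
def writeAnswerProg : ForProg :=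
  .ite (.eq (.var 15) (.const 1))
    (.seq (.assign 16 (.const 0)) (.seq (writeProg (.const 1))
      (.seq (.upto 13 1 writeSetProg) (.assign 0 (.var 16)))))
    (.assign 0 (.const 1))

theorem _root_.RAM.State.output_eq (s : State) :
    s.output = (List.range (s.var 0).toNat).map fun j : ℕ => s.arr 1 (j : ℤ) := by
  simp [State.output, List.map_eq_flatMap, List.flatMap_assoc]

theorem Written.output {l : List ℤ} {s : State} (h : Written l s) :
    ((ForProg.assign 0 (.var 16)).run s).output = l := by
  refine List.ext_getElem (by simp [State.output_eq, Expr.eval, h.1]) fun j h1 h2 => ?_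
  have := h.2 j h2
  rw [List.getD_eq_getElem _ _ h2] at this
  simpa [State.output_eq] using this

theorem writeAnswerProg_of_eq_one {s : State} {S : I.Selection} (h15 : s.var 15 = 1)
    (h0 : s.var 0 = I.len) (h1 : s.var 1 = I.m) (ha : s.arr 0 = I.inp)
    (h2 : ∀ i : Fin I.m, s.arr 2 (i : ℕ) = I.off i + 2)
    (h12 : ∀ a : I.Item, s.arr 12 (I.pos a) = if a.2 ∈ S a.1 then 1 else 0) :
    (writeAnswerProg.run s).output = 1 :: I.encodeSelection S := by
  unfold writeAnswerProg
  rw [run_ite_pos (by simpa [Test.Holds, Expr.eval] using h15)]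
  rw [run_seq, run_seq, run_seq]
  apply Written.output
  have hw : Written [] ((ForProg.assign 16 (.const 0)).run s) := by simp [Written, Expr.eval]
  replace hw := writeProg_spec hw (.const 1)
  have hF := run_frame (.seq (.assign 16 (.const 0)) (writeProg (.const 1))) s
  rw [run_seq] at hF
  generalize (writeProg (.const 1)).run ((ForProg.assign 16 (.const 0)).run s) = s1 at *
  have key := run_upto (x := 13) (y := 1) (P := writeSetProg) (by decide) (by decide)
    ((hF.1 0 (by decide)).trans h0) ((hF.1 1 (by decide)).trans h1) I.m_le_len
    (fun i s' => Written (1 :: ((List.finRange I.m).take i).flatMap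
      fun i => List.ofFn fun k => if k ∈ S i then (1 : ℤ) else 0) s')
    (by simpa [Written, Expr.eval] using hw) (fun s' z h => by simpa [Written] using h) ?_
  · rwa [List.take_of_length_le (by simp)] at key
  · intro k s' hk hx hF' hI
    have := writeSetProg_spec (S := S) ⟨k, hk⟩
      ((hF'.1 0 (by decide)).trans ((hF.1 0 (by decide)).trans h0)) hx
      ((hF'.2 0 (by decide)).trans ((hF.2 0 (by decide)).trans ha))
      (by rw [hF'.2 2 (by decide), hF.2 2 (by decide)]; exact h2 ⟨k, hk⟩)
      (by rw [hF'.2 12 (by decide), hF.2 12 (by decide)]; exact h12) hI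
    rw [List.take_succ_eq_append_getElem (by simpa using hk), List.flatMap_append]
    simpa [Written] using this

theorem writeAnswerProg_of_ne_one {s : State} (h15 : s.var 15 ≠ 1) (h1 : s.arr 1 = fun _ => 0) :
    (writeAnswerProg.run s).output = [0] := by
  unfold writeAnswerProg
  rw [run_ite_neg (by simpa [Test.Holds, Expr.eval] using h15)]
  simp [State.output_eq, Expr.eval, h1]

/-! ### The whole program -/

/-- Solves the instances of RIS with transitive forbiddance. -/
def solveProg : ForProg :=
  .seq readSetsProg (.seq readPairsProg (.seq boundProg (.seq hungarianProg
    (.seq selectProg writeAnswerProg))))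

theorem solveProg_spec (hI : I.TransitiveForbiddance) :
    I.IsAnswer (solveProg.run (State.init I.encode)).output := by
  unfold solveProg
  simp only [run_seq]
  have h0 : (State.init I.encode).var 0 = I.len := by simp [State.init]
  have ha : (State.init I.encode).arr 0 = I.inp := rfl
  have hz : ∀ a, a ≠ 0 → (State.init I.encode).arr a = fun _ => 0 := by
    intro a h; funext j; simp [State.init, h]
  generalize State.init I.encode = s0 at *
  obtain ⟨p1, p16, p2, p3, p4⟩ := readSetsProg_spec h0 ha (hz 3 (by decide)) (hz 4 (by decide))
  have hF1 := run_frame readSetsProg s0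
  generalize readSetsProg.run s0 = s1 at *
  have v1 := (hF1.1 0 (by decide)).trans h0
  have a1 := (hF1.2 0 (by decide)).trans ha
  obtain ⟨p5, p6⟩ := readPairsProg_spec v1 p16 a1 p2
    ((hF1.2 6 (by decide)).trans (hz 6 (by decide)))
  have hF2 := run_frame readPairsProg s1
  generalize readPairsProg.run s1 = s2 at *
  have v2 := (hF2.1 0 (by decide)).trans v1
  have a2 := (hF2.2 0 (by decide)).trans a1
  have pb := boundProg_spec v2 a2
  have hF3 := run_frame boundProg s2
  generalize boundProg.run s2 = s3 at *
  have v3 := (hF3.1 0 (by decide)).trans v2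
  have hD : TableOf I s3.table := by
    refine ⟨pb, (hF3.2 0 (by decide)).trans a2, ?_, ?_, ?_, ?_⟩
    · simpa only [State.table, hF3.2 3 (by decide), hF2.2 3 (by decide)] using p3
    · simpa only [State.table, hF3.2 4 (by decide), hF2.2 4 (by decide)] using p4
    · simpa only [State.table, hF3.2 5 (by decide)] using p5
    · simpa only [State.table, hF3.2 6 (by decide)] using p6
  obtain ⟨μ, g1, -, g3, g4⟩ := hungarianProg_spec v3 (fun r j => by
    have h1 := hD.neg_total_le_weight r j
    have h2 := hD.total_lt_bound
    simp only [State.table] at h1 h2 ⊢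
    omega)
  have hF4 := run_frame hungarianProg s3
  generalize hungarianProg.run s3 = s4 at *
  have t4 : s4.table = s3.table := State.table_eq_of_frame hF4 (by decide) (by decide) (by decide)
    (by decide) (by decide) (by decide)
  have z4 : ∀ a, a = 1 ∨ a = 12 → s4.arr a = fun _ => 0 := by
    rintro a (rfl | rfl) <;>
    rw [hF4.2 _ (by decide), hF3.2 _ (by decide), hF2.2 _ (by decide), hF1.2 _ (by decide),
      hz _ (by decide)]
  have hsel := selectProg_spec ((hF4.1 0 (by decide)).trans v3) g1 (z4 12 (by simp))
  rw [t4] at hsel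
  have hF5 := run_frame selectProg s4
  generalize selectProg.run s4 = s5 at *
  rcases hsel with ⟨q1, q2, q3⟩ | ⟨q1, r, q2, q3, q4⟩
  · left
    obtain ⟨S, hS1, hS2⟩ := hD.exists_optimal hI g3 g4 q2
    refine ⟨S, hS1, writeAnswerProg_of_eq_one q1 ?_ ?_ ?_ ?_ ?_⟩
    · rw [hF5.1 0 (by decide), hF4.1 0 (by decide), v3]
    · rw [hF5.1 1 (by decide), hF4.1 1 (by decide), hF3.1 1 (by decide), hF2.1 1 (by decide), p1]
    · rw [hF5.2 0 (by decide), hF4.2 0 (by decide), hF3.2 0 (by decide), a2]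
    · rw [hF5.2 2 (by decide), hF4.2 2 (by decide), hF3.2 2 (by decide), hF2.2 2 (by decide)]
      exact p2
    · intro a
      rw [q3]
      exact if_congr (hS2 a).symm rfl rfl
  · right
    refine ⟨hD.not_feasible hI g4 q2 q4, writeAnswerProg_of_ne_one (by rw [q1]; norm_num) ?_⟩
    rw [hF5.2 1 (by decide), z4 1 (by simp)]

theorem AtMostOnePair.transitiveForbiddance (h : I.AtMostOnePair) : I.TransitiveForbiddance :=
  fun a b d had hab hbd => absurd (h b a d hab.symm hbd) had

theorem SolvableInPolyTime.mono {C C' : RIS → Prop} (h : SolvableInPolyTime C)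
    (hC : ∀ I, C' I → C I) : SolvableInPolyTime C' := by
  obtain ⟨P, q, h⟩ := h
  exact ⟨P, q, fun I hI => h I (hC I hI)⟩

theorem solvableInPolyTime_transitiveForbiddance : SolvableInPolyTime TransitiveForbiddance :=
  ⟨solveProg.compile, _, fun I hI =>
    ⟨_, solveProg_spec hI, outputsWithin_compile (P := solveProg) (by decide) I.encode⟩⟩

end RIS

theorem theorem2 :
    RIS.SolvableInPolyTime RIS.AtMostOnePair ∧
      RIS.SolvableInPolyTime RIS.TransitiveForbiddance :=
  ⟨RIS.solvableInPolyTime_transitiveForbiddance.mono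
    fun _ h => RIS.AtMostOnePair.transitiveForbiddance h,
    RIS.solvableInPolyTime_transitiveForbiddance⟩
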